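/- Let $\mathfrak{f}(\tau) = \zeta_{48}^{-1}\,\eta\!\left(\frac{\tau+1}{2}\right)/\eta(\tau)$, where $\zeta_{48} = e^{2\pi i/48}$ and $\eta$ is the Dedekind eta function, be the Weber function on the upper half-plane $\mathbb{H}$. Let $\ell$ be a prime number not dividing $48$ (that is, $\ell \ge 5$). Then there exists an irreducible polynomial $\Phi_\ell(x,y) \in \mathbb{Z}[x,y]$ with $$\Phi_\ell(\mathfrak{f}(\tau), \mathfrak{f}(\ell\tau)) = 0 \quad \text{for all } \tau \in \mathbb{H}$$ (the Weber modular polynomial of level $\ell$, which is determined up to sign), and every such polynomial satisfies $$\Phi_\ell(\zeta_{24}\, x, \zeta_{24}^{\ell}\, y) = \zeta_{24}^{\ell+1}\, \Phi_\ell(x,y)$$ in $\mathbb{C}[x,y]$ for every primitive $24$-th root of unity $\zeta_{24} \in \mathbb{C}$. -/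

import Mathlib

noncomputable section

namespace WeberModular

/-- The Weber function `𝔣(τ) = ζ₄₈⁻¹ η((τ + 1) / 2) / η(τ)` with `ζ₄₈ = exp(2πi/48)`, where `η` is
the Dedekind eta function. It is only used for `τ` in the upper half-plane. -/
def weberF (τ : ℂ) : ℂ :=
  (Complex.exp (2 * Real.pi * Complex.I / 48))⁻¹ *
    (ModularForm.eta ((τ + 1) / 2) / ModularForm.eta τ)

/-- `Φ ∈ ℤ[x, y]` (with `x = X 0`, `y = X 1`) is a Weber modular polynomial of level `ℓ`: it is
irreducible in `ℤ[x, y]` and `Φ(𝔣(τ), 𝔣(ℓτ)) = 0` for all `τ` in the upper half-plane.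
Such a `Φ` is determined up to sign. -/
def IsWeberModularPolynomial (ℓ : ℕ) (Φ : MvPolynomial (Fin 2) ℤ) : Prop :=
  Irreducible Φ ∧
    ∀ τ : UpperHalfPlane,
      MvPolynomial.aeval ![weberF (τ : ℂ), weberF ((ℓ : ℂ) * (τ : ℂ))] Φ = 0

end WeberModular

end

open Complex Filter Asymptotics Function.Periodic
open scoped Real Topology

noncomputable section

namespace WeberModular

/-! The symmetry comes from `𝔣(τ + 2) = ζ⁻¹ 𝔣(τ)`, where `ζ` is `zeta24`. Replacing `τ` by `τ - 2k`
turns a relation `Φ(𝔣(τ), 𝔣(ℓτ)) = 0` into the relation `Φ(ζᵏ x, ζᵏˡ y)`, where `l` is the level. If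
the relation is unique up to a constant, the two are proportional, and comparing top coefficients in
`y` gives the factor `ζ^(ℓ(ℓ+1)) = ζ^(ℓ+1)`, because `ℓ² ≡ 1 mod 24`.

The work lies in that uniqueness, in the form of a monic relation of minimal degree `ℓ + 1` in `y`.
Lower bound (`IsWeberRelation.eq_zero`): `τ ↦ -1/τ` and `τ ↦ τ + 48` fix `𝔣` and carry `𝔣(ℓτ)` to
the functions `𝔣((τ + 48k)/ℓ)`. Every relation therefore has `ℓ + 1` roots in `y`, and these are
distinct near `i∞` by their leading terms. Existence (`exists_bivariate_conjPoly`): the coefficients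
of `∏ (Y - 𝔣ᵢ)` over these conjugates transform under the theta group by a character, are
holomorphic, bounded at the cusp `1` and meromorphic at `i∞`. Subtracting powers of `𝔣` removes the
pole, and a norm down to level one kills the remainder (`exists_polynomial_of_thetaGroup`), so they
are polynomials in `𝔣`.

The monic relation is rational (`exists_rational_relation`): `𝔣` is a quotient of series with
integral Taylor data, so a `ℚ`-linear retraction `ℂ → ℚ` of the coefficients preserves relations,
and minimality forces equality. A Gauss-type argument (`exists_eq_C_mul_of_irreducible`) makes each
irreducible integral relation a constant multiple of it. Such a relation exists because the integral
relations form a nonzero prime ideal of the factorial ring `ℤ[x][y]`. -/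

/-- The primitive `24`-th root of unity `exp(2πi/24)`. -/
def zeta24 : ℂ := cexp (2 * π * I / 24)

/-! ### Translations acting on `η` and `𝔣`. -/

lemma zeta24_isPrimitiveRoot : IsPrimitiveRoot zeta24 24 := by
  simpa [zeta24] using Complex.isPrimitiveRoot_exp 24 (by norm_num)

lemma zeta24_pow : zeta24 ^ 24 = 1 := zeta24_isPrimitiveRoot.pow_eq_one

lemma zeta24_ne_zero : zeta24 ≠ 0 := Complex.exp_ne_zero _

lemma norm_zeta24 : ‖zeta24‖ = 1 := by
  simpa [zeta24, mul_comm, mul_assoc, mul_div_assoc] using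
    Complex.norm_exp_ofReal_mul_I (2 * π / 24)

lemma zeta24_zpow_eq_of_dvd {m n : ℤ} (h : (24 : ℤ) ∣ m - n) : zeta24 ^ m = zeta24 ^ n := by
  obtain ⟨k, hk⟩ := h
  have : m = n + 24 * k := by omega
  rw [this, zpow_add₀ zeta24_ne_zero, zpow_mul]
  have h24 : zeta24 ^ (24 : ℤ) = 1 := by exact_mod_cast zeta24_pow
  simp [h24]

lemma qParam_add (h : ℝ) (z w : ℂ) : qParam h (z + w) = qParam h z * qParam h w := by
  simp only [qParam, ← Complex.exp_add]
  congr 1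
  ring

lemma eta_add_one (z : ℂ) : ModularForm.eta (z + 1) = zeta24 * ModularForm.eta z := by
  have h1 : qParam 1 (z + 1) = qParam 1 z := by
    rw [qParam_add]
    simp [qParam]
  have h2 : qParam 24 (z + 1) = zeta24 * qParam 24 z := by
    rw [qParam_add, mul_comm]
    simp [qParam, zeta24]
  simp only [ModularForm.eta, ModularForm.eta_q, h1, h2, mul_assoc]

lemma weberF_add_two (z : ℂ) : weberF (z + 2) = zeta24⁻¹ * weberF z := by
  have h1 : (z + 2 + 1) / 2 = (z + 1) / 2 + 1 := by ring
  have h2 : z + 2 = z + 1 + 1 := by ring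
  rw [weberF, weberF, h1, eta_add_one, h2, eta_add_one, eta_add_one]
  have := zeta24_ne_zero
  field_simp

lemma weberF_add_two_mul_nat (n : ℕ) (z : ℂ) :
    weberF (z + 2 * n) = (zeta24 ^ n)⁻¹ * weberF z := by
  induction n with
  | zero => simp
  | succ n ih =>
    have : z + 2 * ((n + 1 : ℕ) : ℂ) = z + 2 * n + 2 := by push_cast; ring
    rw [this, weberF_add_two, ih, pow_succ, mul_inv]
    ring

lemma weberF_add_two_mul_int (n : ℤ) (z : ℂ) :
    weberF (z + 2 * n) = zeta24 ^ (-n) * weberF z := by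
  obtain ⟨n, rfl | rfl⟩ := n.eq_nat_or_neg
  · simp [weberF_add_two_mul_nat]
  · have := weberF_add_two_mul_nat n (z + 2 * ((-n : ℤ) : ℂ))
    have h2 : z + 2 * ((-n : ℤ) : ℂ) + 2 * n = z := by push_cast; ring
    rw [h2] at this
    rw [this]
    have := zeta24_ne_zero
    simp
    field_simp

lemma weberF_add_int_of_dvd {m : ℤ} (hm : (48 : ℤ) ∣ m) (z : ℂ) : weberF (z + m) = weberF z := by
  obtain ⟨k, rfl⟩ := hm
  have := weberF_add_two_mul_int (24 * k) z
  rw [zeta24_zpow_eq_of_dvd (n := 0) (by omega)] at this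
  convert this using 2
  · push_cast; ring
  · simp

/-! ### Invariance of `𝔣` under `τ ↦ -1/τ`. -/

lemma im_neg_one_div_pos {z : ℂ} (hz : 0 < z.im) : 0 < (-1 / z).im := by
  simpa [neg_div] using UpperHalfPlane.im_inv_neg_coe_pos ⟨z, hz⟩

lemma ne_zero_of_im_pos {z : ℂ} (hz : 0 < z.im) : z ≠ 0 := by
  rintro rfl
  simp at hz

lemma im_half_pos {z : ℂ} (hz : 0 < z.im) : 0 < ((z + 1) / 2).im := by
  simpa using hz

lemma im_nat_mul_pos {n : ℕ} (hn : 0 < n) {z : ℂ} (hz : 0 < z.im) : 0 < ((n : ℂ) * z).im := by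
  simp [hz, hn]

lemma weberF_ne_zero {z : ℂ} (hz : 0 < z.im) : weberF z ≠ 0 :=
  mul_ne_zero (inv_ne_zero (Complex.exp_ne_zero _))
    (div_ne_zero (ModularForm.eta_ne_zero (im_half_pos hz)) (ModularForm.eta_ne_zero hz))

lemma differentiableAt_weberF {z : ℂ} (hz : 0 < z.im) : DifferentiableAt ℂ weberF z := by
  have h1 := ModularForm.differentiableAt_eta_of_mem_upperHalfPlaneSet (im_half_pos hz)
  have h2 := ModularForm.differentiableAt_eta_of_mem_upperHalfPlaneSet hz
  have h3 : DifferentiableAt ℂ (fun w : ℂ => ModularForm.eta ((w + 1) / 2)) z :=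
    h1.comp z (f := fun w : ℂ => (w + 1) / 2) (by fun_prop)
  exact (h3.div h2 (ModularForm.eta_ne_zero hz)).const_mul _

lemma sqrt_pow_twentyFour (z : ℂ) : Complex.sqrt z ^ 24 = z ^ 12 := by
  rw [Complex.sqrt, ← Complex.cpow_nat_mul, ← Complex.cpow_natCast]
  norm_num

lemma eta_S_pow {z : ℂ} (hz : 0 < z.im) :
    ModularForm.eta (-1 / z) ^ 24 = z ^ 12 * ModularForm.eta z ^ 24 := by
  have h : ModularForm.eta (-1 / z) = (Complex.sqrt I)⁻¹ * (Complex.sqrt z * ModularForm.eta z) :=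
    ModularForm.eta_comp_eq_csqrt_I_inv hz
  have hI : I ^ 12 = 1 := by
    rw [show 12 = 4 * 3 by norm_num, pow_mul, I_pow_four, one_pow]
  rw [h, mul_pow, mul_pow, inv_pow, sqrt_pow_twentyFour, sqrt_pow_twentyFour, hI]
  simp

lemma eta_add_one_pow (z : ℂ) : ModularForm.eta (z + 1) ^ 24 = ModularForm.eta z ^ 24 := by
  rw [eta_add_one, mul_pow, zeta24_pow, one_mul]

lemma weberF_pow (z : ℂ) :
    weberF z ^ 24 = -(ModularForm.eta ((z + 1) / 2) ^ 24 / ModularForm.eta z ^ 24) := by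
  have h : cexp (2 * π * I / 48) ^ 24 = -1 := by
    rw [← Complex.exp_nat_mul, ← Complex.exp_pi_mul_I]
    congr 1
    push_cast
    ring
  rw [weberF, mul_pow, inv_pow, h, div_pow]
  ring

/-- The power `η²⁴` has weight `12` with trivial multiplier, so no branch of the square root has to
be tracked. With `s = (z - 1)/2`, the point `(-1/z + 1)/2` is reached from `s` by inverting,
translating by `-2` and inverting again; the automorphy factors multiply to `z¹²` and cancel. -/
lemma weberF_S_pow {z : ℂ} (hz : 0 < z.im) : weberF (-1 / z) ^ 24 = weberF z ^ 24 := by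
  have hz0 := ne_zero_of_im_pos hz
  have hs : 0 < ((z + 1) / 2 - 1).im := by simpa using hz
  have hs0 := ne_zero_of_im_pos hs
  set s : ℂ := (z + 1) / 2 - 1 with hsdef
  have hs1 := im_neg_one_div_pos hs
  have hw : 0 < (-1 / s - 1 - 1).im := by simpa using hs1
  have hw0 := ne_zero_of_im_pos hw
  have e1 : (-1 / z + 1) / 2 = -1 / (-1 / s - 1 - 1) := by
    have hzs : z = 2 * s + 1 := by rw [hsdef]; ring
    have h3 : -1 / s - 1 - 1 = -(2 * s + 1) / s := by field_simp; ring
    rw [hzs] at hz0 ⊢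
    rw [h3]
    field_simp
    ring
  have e2 : ∀ w, ModularForm.eta (w - 1) ^ 24 = ModularForm.eta w ^ 24 := fun w => by
    rw [← eta_add_one_pow, sub_add_cancel]
  have e3 : (-1 / s - 1 - 1) * s = -z := by
    have hzs : z = 2 * s + 1 := by rw [hsdef]; ring
    rw [hzs]
    field_simp
    ring
  rw [weberF_pow, weberF_pow, e1, eta_S_pow hw, eta_S_pow hz, e2, e2, eta_S_pow hs, ← mul_assoc,
    ← mul_pow, e3, hsdef, e2]
  have := ModularForm.eta_ne_zero hz
  field_simp

lemma isPreconnected_upperHalfPlane : IsPreconnected {z : ℂ | 0 < z.im} :=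
  (convex_halfSpace_im_gt 0).isPreconnected

lemma isOpen_upperHalfPlane : IsOpen {z : ℂ | 0 < z.im} :=
  UpperHalfPlane.isOpen_upperHalfPlaneSet

lemma eq_of_pow_eq_one {u : ℂ → ℂ} {n : ℕ} (hn : n ≠ 0)
    (hu : ∀ z : ℂ, 0 < z.im → DifferentiableAt ℂ u z) (h1 : ∀ z : ℂ, 0 < z.im → u z ^ n = 1)
    {z w : ℂ} (hz : 0 < z.im) (hw : 0 < w.im) : u z = u w := by
  refine isOpen_upperHalfPlane.is_const_of_deriv_eq_zero isPreconnected_upperHalfPlane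
    (f := u) (fun x hx => (hu x hx).differentiableWithinAt) ?_ hz hw
  intro x hx
  have hev : (fun y => u y ^ n) =ᶠ[𝓝 x] fun _ => 1 :=
    Filter.eventually_of_mem (isOpen_upperHalfPlane.mem_nhds hx) h1
  have hd := hev.deriv_eq
  rw [deriv_fun_pow (hu x hx), deriv_const] at hd
  have hx0 : u x ≠ 0 := fun h0 => by simpa [h0, hn] using h1 x hx
  simpa [hn, hx0] using hd

/-- The quotient of the two sides has 24th power `1`, hence is constant on the connected half-plane,
and it equals `1` at the fixed point `I`. -/
lemma weberF_S {z : ℂ} (hz : 0 < z.im) : weberF (-1 / z) = weberF z := by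
  have hI : 0 < I.im := by simp
  have key := eq_of_pow_eq_one (u := fun z => weberF (-1 / z) / weberF z) (n := 24) (by norm_num)
    (fun w hw => ?_) (fun w hw => ?_) hz hI
  · have h1 : -1 / I = I := by
      rw [div_eq_iff I_ne_zero, I_mul_I]
    simp only [h1, div_self (weberF_ne_zero hI)] at key
    exact (div_eq_one_iff_eq (weberF_ne_zero hz)).mp key
  · refine DifferentiableAt.div ?_ (differentiableAt_weberF hw) (weberF_ne_zero hw)
    exact (differentiableAt_weberF (im_neg_one_div_pos hw)).comp w (f := fun w : ℂ => -1 / w)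
      (DifferentiableAt.div (by fun_prop) (by fun_prop) (ne_zero_of_im_pos hw))
  · rw [div_pow, weberF_S_pow hw, div_self (pow_ne_zero _ (weberF_ne_zero hw))]

/-! ### Product expansion and behaviour at the cusps `i∞` and `1`. -/

/-- The Euler product `∏ (1 - xⁿ)`. -/
def eulerProd (x : ℂ) : ℂ := ∏' n : ℕ, (1 - x ^ (n + 1))

lemma eta_eq (z : ℂ) : ModularForm.eta z = qParam 24 z * eulerProd (qParam 1 z) := rfl

lemma weberF_eq (z : ℂ) : weberF z = (qParam 48 z)⁻¹ *
    (eulerProd (-qParam 48 z ^ 24) / eulerProd (qParam 48 z ^ 48)) := by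
  have h1 : qParam 1 z = qParam 48 z ^ 48 := by
    simp only [qParam, ← Complex.exp_nat_mul]
    congr 1; push_cast; ring
  have h2 : qParam 1 ((z + 1) / 2) = -qParam 48 z ^ 24 := by
    rw [neg_eq_neg_one_mul, ← Complex.exp_pi_mul_I]
    simp only [qParam, ← Complex.exp_nat_mul, ← Complex.exp_add]
    congr 1; push_cast; ring
  have h3 : qParam 24 z = qParam 48 z ^ 2 := by
    simp only [qParam, ← Complex.exp_nat_mul]
    congr 1; push_cast; ring
  have h4 : qParam 24 ((z + 1) / 2) = cexp (2 * π * I / 48) * qParam 48 z := by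
    simp only [qParam, ← Complex.exp_add]
    congr 1; push_cast; ring
  rw [weberF, eta_eq, eta_eq, h1, h2, h3, h4]
  have := Complex.exp_ne_zero (2 * π * I / 48)
  have h5 : qParam 48 z ≠ 0 := qParam_ne_zero z
  field_simp

local notation "I∞" => comap Complex.im atTop

lemma differentiableOn_eulerProd : DifferentiableOn ℂ eulerProd (Metric.ball 0 1) :=
  ModularForm.differentiableOn_tprod_one_sub_pow

lemma tendsto_eulerProd : Tendsto eulerProd (𝓝 0) (𝓝 1) := by
  have h := (differentiableOn_eulerProd.differentiableAt
    (Metric.ball_mem_nhds 0 one_pos)).continuousAt.tendsto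
  simpa [eulerProd] using h

lemma tendsto_qParam_zero {h : ℝ} (hh : 0 < h) : Tendsto (qParam h) I∞ (𝓝 0) :=
  (qParam_tendsto hh).mono_right nhdsWithin_le_nhds

lemma tendsto_qParam_mul_weberF : Tendsto (fun z => qParam 48 z * weberF z) I∞ (𝓝 1) := by
  have hq := tendsto_qParam_zero (h := 48) (by norm_num)
  have h1 : Tendsto (fun z => eulerProd (-qParam 48 z ^ 24)) I∞ (𝓝 1) :=
    tendsto_eulerProd.comp (by simpa using (hq.pow 24).neg)
  have h2 : Tendsto (fun z => eulerProd (qParam 48 z ^ 48)) I∞ (𝓝 1) :=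
    tendsto_eulerProd.comp (by simpa using (hq.pow 48))
  have h3 := h1.div h2 one_ne_zero
  rw [div_one] at h3
  refine h3.congr fun z => ?_
  rw [weberF_eq, mul_inv_cancel_left₀ (qParam_ne_zero z)]
  rfl

lemma tendsto_im_natCast_mul {n : ℕ} (hn : 0 < n) : Tendsto (fun z : ℂ => (n : ℂ) * z) I∞ I∞ := by
  rw [tendsto_comap_iff]
  have : Complex.im ∘ (fun z : ℂ => (n : ℂ) * z) = fun z => (n : ℝ) * z.im := by
    ext z; simp
  rw [this]
  exact tendsto_comap.const_mul_atTop (by exact_mod_cast hn)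

lemma tendsto_im_add_div {n : ℕ} (hn : 0 < n) (x : ℂ) :
    Tendsto (fun z : ℂ => (z + x) / n) I∞ I∞ := by
  rw [tendsto_comap_iff]
  have : Complex.im ∘ (fun z : ℂ => (z + x) / n) = fun z => (z.im + x.im) / (n : ℝ) := by
    ext z; simp
  rw [this]
  exact (tendsto_atTop_add_const_right _ _ tendsto_comap).atTop_div_const (by exact_mod_cast hn)

lemma tendsto_im_add (x : ℂ) : Tendsto (fun z : ℂ => z + x) I∞ I∞ := by
  simpa using tendsto_im_add_div one_pos x

lemma eventually_im_pos : ∀ᶠ z : ℂ in I∞, 0 < z.im :=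
  tendsto_comap.eventually (eventually_gt_atTop 0)

instance : NeBot I∞ := by
  refine comap_neBot fun t ht => ?_
  obtain ⟨a, ha⟩ := (ht : t ∈ atTop) |> Filter.nonempty_of_mem
  exact ⟨⟨0, a⟩, ha⟩

lemma weberF_one_sub_inv_pow {z : ℂ} (hz : 0 < z.im) :
    weberF (1 + -1 / z) ^ 24 =
      -(2 ^ 12 * (ModularForm.eta (2 * z) ^ 24 / ModularForm.eta z ^ 24)) := by
  have hz0 := ne_zero_of_im_pos hz
  have h2 : 0 < (2 * z).im := by simpa using hz
  have e : (1 + -1 / z + 1) / 2 = -1 / (2 * z) + 1 := by field_simp; ring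
  rw [weberF_pow, e, eta_add_one_pow, add_comm 1, eta_add_one_pow, eta_S_pow hz, eta_S_pow h2]
  have := ModularForm.eta_ne_zero hz
  field_simp

/-- The 24th power is `-2¹² Δ(2z)/Δ(z)`, where `Δ = η²⁴`, and this quotient has leading term `q`. -/
lemma tendsto_weberF_cusp_one : Tendsto (fun z => weberF (1 + -1 / z)) I∞ (𝓝 0) := by
  have hq := tendsto_qParam_zero (h := 1) (by norm_num)
  have h1 : Tendsto (fun z => eulerProd (qParam 1 z ^ 2)) I∞ (𝓝 1) :=
    tendsto_eulerProd.comp (by simpa using (hq.pow 2))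
  have h2 : Tendsto (fun z => eulerProd (qParam 1 z)) I∞ (𝓝 1) := tendsto_eulerProd.comp hq
  have h3 := ((hq.mul ((h1.div h2 one_ne_zero).pow 24)).const_mul (2 ^ 12)).neg
  simp only [zero_mul, mul_zero, neg_zero] at h3
  have h4 : Tendsto (fun z => weberF (1 + -1 / z) ^ 24) I∞ (𝓝 0) := by
    refine h3.congr' ?_
    filter_upwards [eventually_im_pos] with z hz
    have e1 : qParam 1 (2 * z) = qParam 1 z ^ 2 := by
      simp only [qParam, ← Complex.exp_nat_mul]
      congr 1; push_cast; ring
    have e2 : qParam 24 (2 * z) ^ 24 = qParam 1 z ^ 2 := by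
      simp only [qParam, ← Complex.exp_nat_mul]
      congr 1; push_cast; ring
    have e3 : qParam 24 z ^ 24 = qParam 1 z := by
      simp only [qParam, ← Complex.exp_nat_mul]
      congr 1; push_cast; ring
    rw [weberF_one_sub_inv_pow hz, eta_eq, eta_eq, mul_pow, mul_pow, e1, e2, e3]
    have : qParam 1 z ≠ 0 := qParam_ne_zero z
    simp only [Pi.div_apply, div_pow]
    field_simp
  rw [tendsto_zero_iff_norm_tendsto_zero] at h4 ⊢
  have h5 := h4.rpow_const (p := 1 / 24) (by norm_num)
  rw [Real.zero_rpow (by norm_num)] at h5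
  refine h5.congr fun z => ?_
  rw [norm_pow, ← Real.rpow_natCast, ← Real.rpow_mul (norm_nonneg _)]
  norm_num

/-! ### The character of `Γ(2)` on `𝔣`. -/

lemma denom_ne_zero_of_det {a b c d : ℤ} (h : 0 < a * d - b * c) {z : ℂ} (hz : 0 < z.im) :
    (c : ℂ) * z + d ≠ 0 := by
  intro h0
  have him := congrArg Complex.im h0
  have hre := congrArg Complex.re h0
  simp at him hre
  rcases him with hc | hc
  · subst hc
    simp at hre
    subst hre
    simp at h
  · exact hz.ne' hc

lemma im_moebius_pos {a b c d : ℤ} (h : 0 < a * d - b * c) {z : ℂ} (hz : 0 < z.im) :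
    0 < (((a : ℂ) * z + b) / (c * z + d)).im := by
  have hN : 0 < Complex.normSq ((c : ℂ) * z + d) :=
    Complex.normSq_pos.mpr (denom_ne_zero_of_det h hz)
  rw [Complex.div_im, ← sub_div]
  refine div_pos ?_ hN
  have hR : (0 : ℝ) < a * d - b * c := by exact_mod_cast h
  simp
  nlinarith [mul_pos hR hz]

/-- This map is `τ ↦ τ - 2` conjugated by the inversion, which fixes `𝔣`. -/
lemma weberF_U {w : ℂ} (hw : 0 < w.im) : weberF (w / (2 * w + 1)) = zeta24 * weberF w := by
  have hw0 := ne_zero_of_im_pos hw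
  have h1 := im_neg_one_div_pos hw
  have h2 : 0 < (-1 / w - 2).im := by simpa using h1
  have h3 : -1 / (-1 / w - 2) = w / (2 * w + 1) := by
    have e : -1 / w - 2 = -(2 * w + 1) / w := by field_simp; ring
    have e' : 2 * w + 1 ≠ 0 := by
      intro h; rw [e, h] at h2; simp at h2
    rw [e]
    field_simp
  have h4 := weberF_add_two (-1 / w - 2)
  rw [sub_add_cancel, weberF_S hw] at h4
  rw [← h3, weberF_S h2, h4, mul_inv_cancel_left₀ zeta24_ne_zero]

lemma weberF_U_neg {w : ℂ} (hw : 0 < w.im) :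
    weberF (w / (-2 * w + 1)) = zeta24⁻¹ * weberF w := by
  have h1 : (-2 * w + 1) ≠ 0 := by
    intro h; have := congrArg Complex.im h; simp at this; linarith
  have h2 : 0 < (w / (-2 * w + 1)).im := by
    simpa using im_moebius_pos (a := 1) (b := 0) (c := -2) (d := 1) (by norm_num) hw
  have h3 := weberF_U h2
  have h4 : w / (-2 * w + 1) / (2 * (w / (-2 * w + 1)) + 1) = w := by
    have : 2 * (w / (-2 * w + 1)) + 1 = 1 / (-2 * w + 1) := by
      rw [eq_div_iff h1, add_mul, mul_assoc, div_mul_cancel₀ _ h1]; ring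
    rw [this, div_div_div_cancel_right₀ h1, div_one]
  rw [h4] at h3
  rw [h3, inv_mul_cancel_left₀ zeta24_ne_zero]

lemma weberF_sub_two (z : ℂ) : weberF (z - 2) = zeta24 * weberF z := by
  have := weberF_add_two (z - 2)
  rw [sub_add_cancel] at this
  rw [this, mul_inv_cancel_left₀ zeta24_ne_zero]

/-- The exponent modulo `24` of the character by which the matrix `!![a, 2 * b; 2 * c, d]` of `Γ(2)` acts
on the Weber function. -/
def weberExp (a b c d : ℤ) : ℤ :=
  -- Chinese remaindering: `9` is `1` mod `8` and `0` mod `3`, while `16` is `0` mod `8` and `1` mod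
  -- `3`.
  9 * (b * d - a * c + 4 * b * c) - 16 * ((a + d) * (2 * c) - 2 * b * d * (4 * c ^ 2 - 1))

lemma dvd_of_three_eight {x : ℤ} (h3 : ((x : ℤ) : ZMod 3) = 0) (h8 : ((x : ℤ) : ZMod 8) = 0) :
    (24 : ℤ) ∣ x := by
  have h3' : (3 : ℤ) ∣ x := (ZMod.intCast_zmod_eq_zero_iff_dvd x 3).mp h3
  have h8' : (8 : ℤ) ∣ x := (ZMod.intCast_zmod_eq_zero_iff_dvd x 8).mp h8
  omega

lemma odd_of_det {a b c d : ℤ} (h : a * d - 4 * b * c = 1) : Odd a ∧ Odd d := by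
  have : Odd (a * d) := ⟨2 * b * c, by linarith⟩
  exact Int.odd_mul.mp this

/-- Compatibility with left multiplication by `τ ↦ τ + 2`. Modulo `3` it is a finite check that uses
the determinant; modulo `8` only the oddness of `d` matters. -/
lemma weberExp_T {a b c d : ℤ} (h : a * d - 4 * b * c = 1) :
    (24 : ℤ) ∣ weberExp (a + 4 * c) (b + d) c d - (weberExp a b c d + 1) := by
  obtain ⟨-, k, rfl⟩ := odd_of_det h
  apply dvd_of_three_eight
  · have key : ∀ a b c d : ZMod 3, a * d - 4 * b * c = 1 →
        (9 * ((b + d) * d - (a + 4 * c) * c + 4 * (b + d) * c) -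
          16 * ((a + 4 * c + d) * (2 * c) - 2 * (b + d) * d * (4 * c ^ 2 - 1))) -
        (9 * (b * d - a * c + 4 * b * c) - 16 * ((a + d) * (2 * c) - 2 * b * d * (4 * c ^ 2 - 1))
          + 1) = 0 := by decide
    have h' := congrArg (Int.cast : ℤ → ZMod 3) h
    push_cast at h'
    have := key a b c _ h'
    rw [weberExp, weberExp]
    push_cast
    exact this
  · have key : ∀ c k : ZMod 8, (2 * k + 1) ^ 2 - 4 * c ^ 2 + 4 * (2 * k + 1) * c - 1 = 0 := by
      decide
    have h16 : (16 : ZMod 8) = 0 := by decide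
    have h9 : (9 : ZMod 8) = 1 := by decide
    have := key c k
    rw [weberExp, weberExp]
    push_cast
    rw [h16, h9]
    refine Eq.trans ?_ this
    ring

lemma weberExp_U {a b c d : ℤ} (h : a * d - 4 * b * c = 1) :
    (24 : ℤ) ∣ weberExp a b (c + a) (d + 4 * b) - (weberExp a b c d - 1) := by
  obtain ⟨⟨k, rfl⟩, -⟩ := odd_of_det h
  apply dvd_of_three_eight
  · have key : ∀ a b c d : ZMod 3, a * d - 4 * b * c = 1 →
        (9 * (b * (d + 4 * b) - a * (c + a) + 4 * b * (c + a)) -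
          16 * ((a + (d + 4 * b)) * (2 * (c + a)) - 2 * b * (d + 4 * b) * (4 * (c + a) ^ 2 - 1))) -
        (9 * (b * d - a * c + 4 * b * c) - 16 * ((a + d) * (2 * c) - 2 * b * d * (4 * c ^ 2 - 1))
          - 1) = 0 := by decide
    have h' := congrArg (Int.cast : ℤ → ZMod 3) h
    push_cast at h'
    have := key _ b c d h'
    rw [weberExp, weberExp]
    push_cast
    exact this
  · have key : ∀ b k : ZMod 8, 4 * b ^ 2 - (2 * k + 1) ^ 2 + 4 * b * (2 * k + 1) + 1 = 0 := by
      decide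
    have h16 : (16 : ZMod 8) = 0 := by decide
    have h9 : (9 : ZMod 8) = 1 := by decide
    have := key b k
    rw [weberExp, weberExp]
    push_cast
    rw [h16, h9]
    refine Eq.trans ?_ this
    ring

lemma weberExp_T_neg {a b c d : ℤ} (h : a * d - 4 * b * c = 1) :
    (24 : ℤ) ∣ weberExp (a - 4 * c) (b - d) c d - (weberExp a b c d - 1) := by
  have := weberExp_T (a := a - 4 * c) (b := b - d) (c := c) (d := d) (by linarith)
  rw [sub_add_cancel, sub_add_cancel] at this
  omega

lemma weberExp_U_neg {a b c d : ℤ} (h : a * d - 4 * b * c = 1) :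
    (24 : ℤ) ∣ weberExp a b (c - a) (d - 4 * b) - (weberExp a b c d + 1) := by
  have := weberExp_U (a := a) (b := b) (c := c - a) (d := d - 4 * b) (by linarith)
  rw [sub_add_cancel, sub_add_cancel] at this
  omega

/-- The transformation law of the Weber function under `Γ(2)`. -/
lemma weberF_gamma_two {a b c d : ℤ} (h : a * d - 4 * b * c = 1) {z : ℂ} (hz : 0 < z.im) :
    weberF ((a * z + 2 * b) / (2 * c * z + d)) = zeta24 ^ (-weberExp a b c d) * weberF z := by
  -- Euclidean descent on the first column, multiplying on the left by `τ ↦ τ ± 2` and `τ ↦ τ/(±2τ +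
  -- 1)`.
  induction hn : a.natAbs + 2 * c.natAbs using Nat.strong_induction_on generalizing a b c d with
  | _ n ih =>
  have hz24 := zeta24_ne_zero
  have hden : ∀ {a b c d : ℤ}, a * d - 4 * b * c = 1 → 2 * (c : ℂ) * z + d ≠ 0 := by
    intro a b c d h
    simpa using denom_ne_zero_of_det (a := a) (b := 2 * b) (c := 2 * c) (d := d)
      (by linarith) hz
  have him : ∀ {a b c d : ℤ}, a * d - 4 * b * c = 1 →
      0 < (((a : ℂ) * z + 2 * b) / (2 * c * z + d)).im := by
    intro a b c d h
    simpa using im_moebius_pos (a := a) (b := 2 * b) (c := 2 * c) (d := d) (by linarith) hz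
  obtain ⟨hao, -⟩ := odd_of_det h
  rcases eq_or_ne c 0 with rfl | hc
  · have had : a * d = 1 := by linarith
    rcases Int.mul_eq_one_iff_eq_one_or_neg_one.mp had with ⟨rfl, rfl⟩ | ⟨rfl, rfl⟩
    · have := weberF_add_two_mul_int b z
      rw [zeta24_zpow_eq_of_dvd (n := -weberExp 1 b 0 1) (by rw [weberExp]; ring_nf; omega)] at this
      simpa using this
    · have := weberF_add_two_mul_int (-b) z
      rw [zeta24_zpow_eq_of_dvd (n := -weberExp (-1) b 0 (-1))
        (by rw [weberExp]; ring_nf; omega)] at this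
      rw [← this]
      congr 1
      push_cast
      field_simp
      ring
  obtain ⟨m, hm⟩ := hao
  -- Since `a` is odd, `|a| ≠ 2|c|`. If `|a|` is larger, some `a ± 4c` is smaller in absolute value;
  -- otherwise some `c ± a` is.
  have cases4 : ((a - 4 * c).natAbs + 2 * c.natAbs < n ∨ (a + 4 * c).natAbs + 2 * c.natAbs < n) ∨
      (a.natAbs + 2 * (c - a).natAbs < n ∨ a.natAbs + 2 * (c + a).natAbs < n) := by
    omega
  rcases cases4 with (hlt | hlt) | (hlt | hlt)
  · have h' : (a - 4 * c) * d - 4 * (b - d) * c = 1 := by linarith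
    have e := ih _ hlt h' rfl
    have e2 := weberF_add_two (((a - 4 * c : ℤ) * z + 2 * (b - d : ℤ)) / (2 * c * z + d))
    rw [e, ← mul_assoc, ← zpow_neg_one, ← zpow_add₀ hz24,
      zeta24_zpow_eq_of_dvd (n := -weberExp a b c d) (by have := weberExp_T_neg h; omega)] at e2
    rw [← e2]
    congr 1
    have := hden h
    push_cast
    rw [eq_comm, div_add' _ _ _ this]
    ring
  · have h' : (a + 4 * c) * d - 4 * (b + d) * c = 1 := by linarith
    have e := ih _ hlt h' rfl
    have e2 := weberF_sub_two (((a + 4 * c : ℤ) * z + 2 * (b + d : ℤ)) / (2 * c * z + d))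
    nth_rw 1 [← zpow_one zeta24] at e2
    rw [e, ← mul_assoc, ← zpow_add₀ hz24,
      zeta24_zpow_eq_of_dvd (n := -weberExp a b c d) (by have := weberExp_T h; omega)] at e2
    rw [← e2]
    congr 1
    have := hden h
    push_cast
    rw [eq_comm, div_sub' this]
    ring
  · have h' : a * (d - 4 * b) - 4 * b * (c - a) = 1 := by linarith
    have e := ih _ hlt h' rfl
    have e2 := weberF_U (him h')
    nth_rw 1 [← zpow_one zeta24] at e2
    rw [e, ← mul_assoc, ← zpow_add₀ hz24,
      zeta24_zpow_eq_of_dvd (n := -weberExp a b c d) (by have := weberExp_U_neg h; omega)] at e2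
    rw [← e2]
    congr 1
    have h1 := hden h
    have h2 := hden h'
    have h3 : 2 * ((a * z + 2 * b) / (2 * (c - a : ℤ) * z + (d - 4 * b : ℤ))) + 1 =
        (2 * c * z + d) / (2 * (c - a : ℤ) * z + (d - 4 * b : ℤ)) := by
      rw [eq_div_iff h2, add_mul, mul_assoc, div_mul_cancel₀ _ h2]
      push_cast
      ring
    rw [h3, div_div_div_cancel_right₀ h2]
  · have h' : a * (d + 4 * b) - 4 * b * (c + a) = 1 := by linarith
    have e := ih _ hlt h' rfl
    have e2 := weberF_U_neg (him h')
    rw [e, ← mul_assoc, ← zpow_neg_one, ← zpow_add₀ hz24,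
      zeta24_zpow_eq_of_dvd (n := -weberExp a b c d) (by have := weberExp_U h; omega)] at e2
    rw [← e2]
    congr 1
    have h1 := hden h
    have h2 := hden h'
    have h3 : -2 * ((a * z + 2 * b) / (2 * (c + a : ℤ) * z + (d + 4 * b : ℤ))) + 1 =
        (2 * c * z + d) / (2 * (c + a : ℤ) * z + (d + 4 * b : ℤ)) := by
      rw [eq_div_iff h2, add_mul, mul_assoc, div_mul_cancel₀ _ h2]
      push_cast
      ring
    rw [h3, div_div_div_cancel_right₀ h2]

lemma norm_weberF_gamma_two {a b c d : ℤ} (h : a * d - 4 * b * c = 1) {z : ℂ} (hz : 0 < z.im) :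
    ‖weberF ((a * z + 2 * b) / (2 * c * z + d))‖ = ‖weberF z‖ := by
  rw [weberF_gamma_two h hz, norm_mul, norm_zpow, norm_zeta24, one_zpow, one_mul]

lemma weberF_gamma_fortyeight {a b c d : ℤ} (h : a * d - 48 * b * (48 * c) = 1) {z : ℂ}
    (hz : 0 < z.im) : weberF ((a * z + 48 * b) / (48 * c * z + d)) = weberF z := by
  have := weberF_gamma_two (a := a) (b := 24 * b) (c := 24 * c) (d := d) (by linarith) hz
  rw [zeta24_zpow_eq_of_dvd (n := 0) (by rw [weberExp]; ring_nf; omega)] at this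
  rw [zpow_zero, one_mul] at this
  rw [← this]
  push_cast
  congr 2 <;> ring

/-! ### The conjugates: permutations, cusp behaviour, distinctness. -/

/-- The `ℓ + 1` conjugates of `𝔣(ℓτ)` over the field generated by `𝔣(τ)`. -/
def weberConj (ℓ : ℕ) : Option (ZMod ℓ) → ℂ → ℂ
  | none, z => weberF (ℓ * z)
  | some k, z => weberF ((z + 48 * (k.val : ℂ)) / ℓ)

/-- Any integer representative of the residue class may be used, because `𝔣` has period `48`. -/
lemma weberConj_intCast {ℓ : ℕ} [NeZero ℓ] (m : ℤ) (z : ℂ) :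
    weberConj ℓ (some (m : ZMod ℓ)) z = weberF ((z + 48 * m) / ℓ) := by
  have hℓ : (ℓ : ℂ) ≠ 0 := by exact_mod_cast NeZero.ne ℓ
  have h1 : (((m : ZMod ℓ).val : ℤ) : ZMod ℓ) = (m : ZMod ℓ) := by simp
  obtain ⟨t, ht⟩ := (ZMod.intCast_eq_intCast_iff_dvd_sub _ _ _).mp h1
  have h2 : (m : ℂ) = ((m : ZMod ℓ).val : ℂ) + ℓ * t := by
    have : m = ((m : ZMod ℓ).val : ℤ) + ℓ * t := by linarith
    exact_mod_cast congrArg (Int.cast : ℤ → ℂ) this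
  have h3 := weberF_add_int_of_dvd (m := 48 * t) ⟨t, rfl⟩ ((z + 48 * ((m : ZMod ℓ).val : ℂ)) / ℓ)
  rw [weberConj, ← h3, h2]
  congr 1
  push_cast
  field_simp
  ring

/-- The permutation of the conjugates induced by `τ ↦ -1/τ`. -/
def permS (ℓ : ℕ) [Fact ℓ.Prime] : Option (ZMod ℓ) → Option (ZMod ℓ)
  | none => some 0
  | some k => if k = 0 then none else some (-(48 ^ 2)⁻¹ * k⁻¹)

lemma fortyeight_ne_zero {ℓ : ℕ} [Fact ℓ.Prime] (h48 : ℓ.Coprime 48) : (48 : ZMod ℓ) ≠ 0 := by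
  have h := (ZMod.isUnit_iff_coprime 48 ℓ).mpr h48.symm
  exact_mod_cast h.ne_zero

lemma permS_involutive {ℓ : ℕ} [Fact ℓ.Prime] (h48 : ℓ.Coprime 48) :
    Function.Involutive (permS ℓ) := by
  have h := fortyeight_ne_zero h48
  intro i
  rcases i with _ | k
  · simp [permS]
  · by_cases hk : k = 0
    · simp [permS, hk]
    · simp only [permS, hk, if_false]
      rw [if_neg]
      · congr 1
        field_simp
      · simp [h, hk]

lemma weberConj_S {ℓ : ℕ} [Fact ℓ.Prime] (h48 : ℓ.Coprime 48) (i : Option (ZMod ℓ)) {z : ℂ}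
    (hz : 0 < z.im) : weberConj ℓ i (-1 / z) = weberConj ℓ (permS ℓ i) z := by
  have hℓ0 : 0 < ℓ := (Fact.out : ℓ.Prime).pos
  have hℓ : (ℓ : ℂ) ≠ 0 := by exact_mod_cast hℓ0.ne'
  have hz0 := ne_zero_of_im_pos hz
  have hdiv : ∀ x : ℕ, 0 < ((z + 48 * (x : ℂ)) / ℓ).im := fun x => by simp [hz, hℓ0]
  rcases i with _ | k
  · have h1 : 0 < (z / ℓ).im := by simpa using hdiv 0
    simp only [permS, weberConj, ZMod.val_zero, Nat.cast_zero, mul_zero, add_zero]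
    rw [← weberF_S h1]
    congr 1
    field_simp
  · by_cases hk : k = 0
    · subst hk
      simp only [permS, weberConj, ZMod.val_zero, Nat.cast_zero, mul_zero, add_zero, if_true]
      rw [← weberF_S (im_nat_mul_pos hℓ0 hz)]
      congr 1
      field_simp
    · simp only [permS, hk, if_false, weberConj]
      set m := k.val with hm
      set m' := (-(48 ^ 2)⁻¹ * k⁻¹ : ZMod ℓ).val with hm'
      -- The cofactor `t` of this divisibility completes `!![-ℓ, 48m'; 48m, -t]` to determinant `1`,
      -- a matrix under which `𝔣` is invariant.
      have hdvd : (ℓ : ℤ) ∣ 48 * m * (48 * m') + 1 := by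
        rw [← ZMod.intCast_zmod_eq_zero_iff_dvd]
        have h := fortyeight_ne_zero h48
        push_cast
        rw [hm, hm', ZMod.natCast_zmod_val, ZMod.natCast_zmod_val]
        field_simp
        ring
      obtain ⟨t, ht⟩ := hdvd
      set w := (z + 48 * (m' : ℂ)) / ℓ with hw
      have hzw : z = ℓ * w - 48 * m' := by rw [hw]; field_simp; ring
      have htC : (ℓ : ℂ) * t = 48 * m * (48 * m') + 1 := by exact_mod_cast ht.symm
      have hpos : 0 < ((-1 / z + 48 * (m : ℂ)) / ℓ).im := by
        simpa [hℓ0] using im_neg_one_div_pos hz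
      have key := weberF_gamma_fortyeight (a := -ℓ) (b := m') (c := m) (d := -t)
        (by linarith) (hdiv m')
      rw [← key, ← weberF_S hpos]
      have e : (-1 / z + 48 * (m : ℂ)) / ℓ = (48 * m * z - 1) / (ℓ * z) := by
        field_simp
        ring
      have e1 : 48 * (m : ℂ) * z - 1 = ℓ * (48 * m * w - t) := by
        rw [mul_sub, htC, hzw]; ring
      have e2 : ((-ℓ : ℤ) : ℂ) * w + 48 * ((m' : ℤ) : ℂ) = -z := by
        rw [hzw]; push_cast; ring
      rw [e, e1, mul_div_mul_left _ _ hℓ, ← hw, e2]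
      congr 1
      push_cast
      rw [← sub_eq_add_neg, neg_div, neg_div, one_div_div]

/-- The permutation of the conjugates induced, up to a root of unity, by `τ ↦ τ + 2`. -/
def permT (ℓ : ℕ) : Option (ZMod ℓ) ≃ Option (ZMod ℓ) :=
  Equiv.optionCongr (Equiv.subRight (((ℓ ^ 2 - 1) / 24 : ℤ) : ZMod ℓ))

lemma sq_eq_of_coprime {ℓ : ℕ} (h48 : ℓ.Coprime 48) :
    (ℓ : ℤ) ^ 2 = 1 + 24 * (((ℓ : ℤ) ^ 2 - 1) / 24) := by
  have h2 : ¬ 2 ∣ ℓ := fun h => by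
    have := Nat.dvd_gcd h (by norm_num : 2 ∣ 48); rw [h48] at this; omega
  have h3 : ¬ 3 ∣ ℓ := fun h => by
    have := Nat.dvd_gcd h (by norm_num : 3 ∣ 48); rw [h48] at this; omega
  have key : ∀ x : ZMod 24, x.val % 2 ≠ 0 → x.val % 3 ≠ 0 → x ^ 2 - 1 = 0 := by decide
  have h24 := key (ℓ : ZMod 24) (by rw [ZMod.val_natCast]; omega) (by rw [ZMod.val_natCast]; omega)
  have hd : (24 : ℤ) ∣ (ℓ : ℤ) ^ 2 - 1 := by
    refine (ZMod.intCast_zmod_eq_zero_iff_dvd _ 24).mp ?_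
    exact_mod_cast h24
  omega

/-- With `t = (ℓ² - 1)/24` one has `2 + 48t = 2ℓ²`, so `(z + 2 + 48k)/ℓ = (z + 48(k - t))/ℓ + 2ℓ`.
Every conjugate thus picks up the same root of unity. -/
lemma weberConj_add_two {ℓ : ℕ} [NeZero ℓ] (h48 : ℓ.Coprime 48) (i : Option (ZMod ℓ)) (z : ℂ) :
    weberConj ℓ i (z + 2) = (zeta24 ^ ℓ)⁻¹ * weberConj ℓ (permT ℓ i) z := by
  have hℓ : (ℓ : ℂ) ≠ 0 := by exact_mod_cast NeZero.ne ℓ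
  rcases i with _ | k
  · simp only [permT, weberConj, Equiv.optionCongr_apply, Option.map_none]
    rw [← weberF_add_two_mul_nat]
    congr 1
    ring
  · have hsq := sq_eq_of_coprime h48
    set t := ((ℓ : ℤ) ^ 2 - 1) / 24 with ht
    have h1 : permT ℓ (some k) = some (((k.val : ℤ) - t : ℤ) : ZMod ℓ) := by
      simp [permT, ht]
    have hC : (ℓ : ℂ) ^ 2 = 1 + 24 * t := by exact_mod_cast congrArg (Int.cast : ℤ → ℂ) hsq
    rw [h1, weberConj_intCast, ← weberF_add_two_mul_nat, weberConj]
    congr 1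
    push_cast
    field_simp
    linear_combination (-2) * hC

lemma weberConj_add_fortyeight {ℓ : ℕ} [NeZero ℓ] (i : Option (ZMod ℓ)) (z : ℂ) :
    weberConj ℓ i (z + 48) = weberConj ℓ (Equiv.optionCongr (Equiv.addRight 1) i) z := by
  have hℓ : (ℓ : ℂ) ≠ 0 := by exact_mod_cast NeZero.ne ℓ
  rcases i with _ | k
  · have := weberF_add_int_of_dvd (m := 48 * ℓ) ⟨ℓ, rfl⟩ (ℓ * z)
    simp only [weberConj, Equiv.optionCongr_apply, Option.map_none]
    rw [← this]
    congr 1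
    push_cast
    ring
  · have h1 : (Equiv.optionCongr (Equiv.addRight (1 : ZMod ℓ))) (some k) =
        some (((k.val : ℤ) + 1 : ℤ) : ZMod ℓ) := by simp
    rw [h1, weberConj_intCast, weberConj]
    congr 1
    push_cast
    ring

lemma differentiableAt_weberConj {ℓ : ℕ} [NeZero ℓ] (i : Option (ZMod ℓ)) {z : ℂ}
    (hz : 0 < z.im) : DifferentiableAt ℂ (weberConj ℓ i) z := by
  have hℓ : 0 < ℓ := NeZero.pos ℓ
  rcases i with _ | k
  · exact (differentiableAt_weberF (im_nat_mul_pos hℓ hz)).comp z (f := fun z : ℂ => (ℓ : ℂ) * z)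
      (by fun_prop)
  · refine (differentiableAt_weberF (z := (z + 48 * (k.val : ℂ)) / ℓ) ?_).comp z
      (f := fun z : ℂ => (z + 48 * (k.val : ℂ)) / ℓ) (by fun_prop)
    generalize k.val = x
    simp [hz, hℓ]

/-- Each conjugate is, up to a factor of norm `1`, the function `𝔣(1 - 1/w)` with `w` an affine
function of `z` tending to `i∞`. The reason is that `ℓ` and `48k + 1` are odd, so only cusps
equivalent to `1` occur. -/
lemma tendsto_weberConj_cusp_one {ℓ : ℕ} [Fact ℓ.Prime] (h48 : ℓ.Coprime 48)
    (i : Option (ZMod ℓ)) : Tendsto (fun z => weberConj ℓ i (1 + -1 / z)) I∞ (𝓝 0) := by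
  have hℓ0 : 0 < ℓ := (Fact.out : ℓ.Prime).pos
  have hℓ : (ℓ : ℂ) ≠ 0 := by exact_mod_cast hℓ0.ne'
  have hodd : Odd (ℓ : ℤ) := by
    rw [Int.odd_coe_nat]
    exact (Nat.Coprime.coprime_dvd_right (by norm_num : 2 ∣ 48) h48).odd_of_right
  have hnorm : ∀ (n : ℤ), Odd n → ∀ u : ℂ, ‖weberF (n + u)‖ = ‖weberF (1 + u)‖ := by
    rintro _ ⟨r, rfl⟩ u
    have := weberF_add_two_mul_int r (1 + u)
    have e : ((2 * r + 1 : ℤ) : ℂ) + u = 1 + u + 2 * r := by push_cast; ring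
    rw [e, this, norm_mul, norm_zpow, norm_zeta24, one_zpow, one_mul]
  have hlim := tendsto_zero_iff_norm_tendsto_zero.mp tendsto_weberF_cusp_one
  rw [tendsto_zero_iff_norm_tendsto_zero]
  have h0 : Tendsto (fun z : ℂ => z / ℓ) I∞ I∞ := by simpa using tendsto_im_add_div hℓ0 0
  rcases i with _ | k
  · refine (hlim.comp h0).congr fun z => ?_
    simp only [weberConj, Function.comp]
    have := hnorm ℓ hodd (-1 / (z / ℓ))
    rw [← this]
    congr 2
    push_cast
    rw [div_div_eq_mul_div]
    ring
  · set n : ℤ := 48 * k.val + 1 with hn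
    have hnodd : Odd n := ⟨24 * k.val, by rw [hn]; ring⟩
    have e0 : ∀ z : ℂ, z ≠ 0 → (1 + -1 / z + 48 * (k.val : ℂ)) / ℓ = (n * z - 1) / (ℓ * z) := by
      intro z hz
      rw [hn]
      push_cast
      field_simp
      ring
    by_cases hdvd : (ℓ : ℤ) ∣ n
    · obtain ⟨s, hs⟩ := hdvd
      have hsodd : Odd s := by rw [hs] at hnodd; exact (Int.odd_mul.mp hnodd).2
      refine (hlim.comp (tendsto_im_natCast_mul hℓ0)).congr' ?_
      filter_upwards [eventually_im_pos] with z hz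
      have hz0 := ne_zero_of_im_pos hz
      simp only [weberConj, Function.comp]
      rw [e0 z hz0, ← hnorm s hsodd, hs]
      congr 2
      push_cast
      field_simp
      ring
    · have hn0 : (n : ZMod ℓ) ≠ 0 := by rwa [Ne, ZMod.intCast_zmod_eq_zero_iff_dvd]
      -- Evenness can be arranged by adding the odd number `ℓ`; it puts the matrix `!![t, n - t; m,
      -- ℓ - m]` used below in `Γ(2)`.
      obtain ⟨m, hmeven, hm⟩ : ∃ m : ℤ, Even m ∧ (ℓ : ℤ) ∣ n * m + 1 := by
        have h1 : (ℓ : ℤ) ∣ n * ((-(n : ZMod ℓ)⁻¹).val : ℤ) + 1 := by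
          rw [← ZMod.intCast_zmod_eq_zero_iff_dvd]
          push_cast
          rw [ZMod.natCast_zmod_val]
          field_simp
          ring
        rcases Int.even_or_odd ((-(n : ZMod ℓ)⁻¹).val : ℤ) with h | h
        · exact ⟨_, h, h1⟩
        · refine ⟨_, h.add_odd hodd, ?_⟩
          rw [mul_add, add_right_comm]
          exact dvd_add h1 (dvd_mul_left _ _)
      obtain ⟨t, ht⟩ := hm
      have htodd : Odd t := by
        have : Odd ((ℓ : ℤ) * t) := by
          rw [← ht]; exact (hmeven.mul_left n).add_one
        exact (Int.odd_mul.mp this).2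
      obtain ⟨p, hp⟩ := (hnodd.sub_odd htodd).two_dvd
      obtain ⟨q, hq⟩ := hmeven.two_dvd
      refine (hlim.comp (tendsto_im_add_div hℓ0 m)).congr' ?_
      filter_upwards [eventually_im_pos] with z hz
      have hz0 := ne_zero_of_im_pos hz
      simp only [weberConj, Function.comp]
      rw [e0 z hz0]
      have hw : 0 < ((z + m) / ℓ).im := by simp [hz, hℓ0]
      set w := (z + m) / ℓ with hwdef
      have hw0 := ne_zero_of_im_pos hw
      have hu : 0 < (1 + -1 / w).im := by simpa using im_neg_one_div_pos hw
      rw [← norm_weberF_gamma_two (a := t) (b := p) (c := q) (d := ℓ - m) ?_ hu]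
      · have hzw : z = ℓ * w - m := by rw [hwdef]; field_simp; ring
        have htC : (n : ℂ) * m + 1 = ℓ * t := by exact_mod_cast congrArg (Int.cast : ℤ → ℂ) ht
        have hpC : 2 * (p : ℂ) = n - t := by exact_mod_cast congrArg (Int.cast : ℤ → ℂ) hp.symm
        have hqC : 2 * (q : ℂ) = m := by exact_mod_cast congrArg (Int.cast : ℤ → ℂ) hq.symm
        congr 2
        rw [hpC, hqC]
        have e1 : (n : ℂ) * z - 1 = ℓ * (n * w - t) := by
          rw [mul_sub, ← htC, hzw]; ring
        have e2 : (t : ℂ) * (1 + -1 / w) + (n - t) = (n * w - t) / w := by field_simp; ring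
        have e3 : (m : ℂ) * (1 + -1 / w) + ((ℓ - m : ℤ) : ℂ) = z / w := by
          rw [hzw]; push_cast; field_simp; ring
        rw [e1, mul_div_mul_left _ _ hℓ, e2, e3, div_div_div_cancel_right₀ hw0]
      · have h1 : t * (ℓ - m) - (2 * p) * (2 * q) = 1 := by
          rw [← hp, ← hq]; linear_combination -ht
        linarith

lemma qParam_natCast_mul (h : ℝ) (n : ℕ) (z : ℂ) : qParam h (n * z) = qParam h z ^ n := by
  simp only [qParam, ← Complex.exp_nat_mul]
  congr 1
  ring

lemma tendsto_weberConj_none {ℓ : ℕ} [NeZero ℓ] :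
    Tendsto (fun z => qParam 48 z ^ ℓ * weberConj ℓ none z) I∞ (𝓝 1) := by
  refine (tendsto_qParam_mul_weberF.comp (tendsto_im_natCast_mul (NeZero.pos ℓ))).congr fun z => ?_
  simp [weberConj, qParam_natCast_mul]

lemma tendsto_weberConj_some {ℓ : ℕ} [NeZero ℓ] (k : ZMod ℓ) :
    Tendsto (fun z => qParam 48 (z / ℓ) * weberConj ℓ (some k) z) I∞
      (𝓝 (cexp (2 * π * I / ℓ) ^ k.val)⁻¹) := by
  have h := (tendsto_qParam_mul_weberF.comp
    (tendsto_im_add_div (NeZero.pos ℓ) (48 * (k.val : ℂ)))).const_mul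
      ((cexp (2 * π * I / ℓ) ^ k.val)⁻¹)
  rw [mul_one] at h
  refine h.congr fun z => ?_
  have e : qParam 48 ((z + 48 * (k.val : ℂ)) / ℓ) =
      qParam 48 (z / ℓ) * cexp (2 * π * I / ℓ) ^ k.val := by
    rw [add_div, qParam_add, ← Complex.exp_nat_mul]
    congr 1
    rw [qParam]
    congr 1
    push_cast
    ring
  have h0 : cexp (2 * π * I / ℓ) ^ k.val ≠ 0 := pow_ne_zero _ (Complex.exp_ne_zero _)
  simp only [Function.comp, weberConj, e]
  field_simp

lemma tendsto_weberConj_some_zero {ℓ : ℕ} [NeZero ℓ] (hℓ : 1 < ℓ) (k : ZMod ℓ) :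
    Tendsto (fun z => qParam 48 z ^ ℓ * weberConj ℓ (some k) z) I∞ (𝓝 0) := by
  have h0 : Tendsto (fun z : ℂ => z / ℓ) I∞ I∞ := by
    simpa using tendsto_im_add_div (NeZero.pos ℓ) 0
  have h1 := ((tendsto_qParam_zero (h := 48) (by norm_num)).comp h0).pow (ℓ ^ 2 - 1)
  have hne : ℓ ^ 2 - 1 ≠ 0 := by
    have : 1 < ℓ ^ 2 := Nat.one_lt_pow (by norm_num) hℓ
    omega
  rw [zero_pow hne] at h1
  have h2 := h1.mul (tendsto_weberConj_some k)
  rw [zero_mul] at h2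
  refine h2.congr fun z => ?_
  have hz : z = ℓ * (z / ℓ) := by
    have : (ℓ : ℂ) ≠ 0 := by exact_mod_cast NeZero.ne ℓ
    field_simp
  have e : qParam 48 z ^ ℓ = qParam 48 (z / ℓ) ^ (ℓ ^ 2 - 1) * qParam 48 (z / ℓ) := by
    rw [← pow_succ, Nat.sub_add_cancel (Nat.one_le_pow _ _ (NeZero.pos ℓ)), pow_two, pow_mul,
      ← qParam_natCast_mul _ _ (z / ℓ), ← hz]
  rw [e, mul_assoc]
  rfl

/-- The conjugate `𝔣(ℓz)` grows like `q^(-ℓ)`. The others grow only like `q^(-1/ℓ)`, with distinct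
`ℓ`-th roots of unity as leading coefficients. -/
lemma eventually_injective_weberConj {ℓ : ℕ} [NeZero ℓ] (hℓ : 1 < ℓ) :
    ∀ᶠ z in I∞, Function.Injective fun i => weberConj ℓ i z := by
  have key : ∀ i j : Option (ZMod ℓ), i ≠ j →
      ∀ᶠ z in I∞, weberConj ℓ i z ≠ weberConj ℓ j z := by
    have hn : ∀ k : ZMod ℓ, ∀ᶠ z in I∞, weberConj ℓ none z ≠ weberConj ℓ (some k) z := fun k => by
      filter_upwards [((tendsto_weberConj_none (ℓ := ℓ)).sub
        (tendsto_weberConj_some_zero hℓ k)).eventually_ne (b₂ := 0) (by simp)] with z hz h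
      exact hz (by rw [h, sub_self])
    rintro (_ | k) (_ | k') hne
    · exact absurd rfl hne
    · exact hn k'
    · filter_upwards [hn k] with z hz using hz.symm
    · have hprim := Complex.isPrimitiveRoot_exp ℓ (NeZero.ne ℓ)
      have hlim : (cexp (2 * π * I / ℓ) ^ k.val)⁻¹ ≠ (cexp (2 * π * I / ℓ) ^ k'.val)⁻¹ := by
        intro h
        have := hprim.pow_inj (ZMod.val_lt k) (ZMod.val_lt k') (inv_injective h)
        exact hne (congrArg some (ZMod.val_injective ℓ this))
      filter_upwards [((tendsto_weberConj_some k).sub (tendsto_weberConj_some k')).eventually_ne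
        (sub_ne_zero.mpr hlim)] with z hz h
      exact hz (by rw [h, sub_self])
  have h2 : ∀ᶠ z in I∞, ∀ i j : Option (ZMod ℓ), i ≠ j → weberConj ℓ i z ≠ weberConj ℓ j z := by
    rw [eventually_all]; intro i
    rw [eventually_all]; intro j
    by_cases h : i = j
    · simp [h]
    · simpa [h] using key i j h
  filter_upwards [h2] with z hz i j hij
  by_contra h
  exact hz i j h hij

/-! ### Holomorphic functions on the theta group are polynomials in `𝔣`. -/

open scoped MatrixGroups in
/-- A holomorphic function of level one and weight zero which vanishes at infinity is zero. -/
lemma eq_zero_of_levelOne {G : ℂ → ℂ} (hd : ∀ z : ℂ, 0 < z.im → DifferentiableAt ℂ G z)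
    (hT : ∀ z : ℂ, 0 < z.im → G (z + 1) = G z) (hS : ∀ z : ℂ, 0 < z.im → G (-1 / z) = G z)
    (h0 : Tendsto G I∞ (𝓝 0)) {z : ℂ} (hz : 0 < z.im) : G z = 0 := by
  let g : UpperHalfPlane → ℂ := fun τ => G τ
  have hgS : SlashAction.map (0 : ℤ) ModularGroup.S g = g := by
    ext τ
    rw [ModularForm.SL_slash_apply, UpperHalfPlane.modular_S_smul]
    have := hS τ τ.2
    simpa [g, neg_div] using this
  have hgT : SlashAction.map (0 : ℤ) ModularGroup.T g = g := by
    ext τ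
    rw [ModularForm.SL_slash_apply, UpperHalfPlane.modular_T_smul]
    have := hT τ τ.2
    simpa [g, add_comm] using this
  have hlim : Tendsto g UpperHalfPlane.atImInfty (𝓝 0) :=
    h0.comp UpperHalfPlane.tendsto_coe_atImInfty
  let F : ModularForm 𝒮ℒ 0 :=
    { toFun := g
      slash_action_eq' := by
        rintro A ⟨A, rfl⟩
        exact SlashInvariantForm.slash_action_generators_SL2Z hgS hgT A
      holo' := by
        rw [UpperHalfPlane.mdifferentiable_iff]
        refine DifferentiableOn.congr (f := G)
          (fun z hz => (hd z hz).differentiableWithinAt) fun z hz => ?_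
        simp [g, UpperHalfPlane.ofComplex_apply_of_im_pos hz]
      bdd_at_cusps' := by
        intro c hc
        rw [Subgroup.IsArithmetic.isCusp_iff_isCusp_SL2Z] at hc
        rw [OnePoint.isBoundedAt_iff_forall_SL2Z hc]
        intro γ _
        have := SlashInvariantForm.slash_action_generators_SL2Z hgS hgT γ
        rw [this]
        exact ZeroAtFilter.boundedAtFilter hlim }
  obtain ⟨c, hc⟩ := ModularFormClass.levelOne_weight_zero_const F
  have hc' : g = fun _ => c := hc
  have hc0 : c = 0 := by
    rw [hc'] at hlim
    exact tendsto_nhds_unique tendsto_const_nhds hlim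
  have := congrFun hc' ⟨z, hz⟩
  rw [hc0] at this
  exact this

lemma analyticOnNhd_of_differentiableAt {h : ℂ → ℂ}
    (hd : ∀ z : ℂ, 0 < z.im → DifferentiableAt ℂ h z) :
    AnalyticOnNhd ℂ h {z : ℂ | 0 < z.im} :=
  DifferentiableOn.analyticOnNhd (fun z hz => (hd z hz).differentiableWithinAt)
    isOpen_upperHalfPlane

lemma eq_zero_or_eq_zero_of_mul_eq_zero {g h : ℂ → ℂ}
    (hg : ∀ z : ℂ, 0 < z.im → DifferentiableAt ℂ g z)
    (hh : ∀ z : ℂ, 0 < z.im → DifferentiableAt ℂ h z)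
    (hgh : ∀ z : ℂ, 0 < z.im → g z * h z = 0) :
    (∀ z : ℂ, 0 < z.im → g z = 0) ∨ (∀ z : ℂ, 0 < z.im → h z = 0) :=
  AnalyticOnNhd.eq_zero_or_eq_zero_of_mul_eq_zero (analyticOnNhd_of_differentiableAt hg)
    (analyticOnNhd_of_differentiableAt hh) hgh isPreconnected_upperHalfPlane

/-- A holomorphic function on the upper half-plane which transforms under the theta group by a
character of order dividing `24`, is bounded at the cusp `1` and vanishes at infinity, is zero. -/
lemma eq_zero_of_thetaGroup {h : ℂ → ℂ} {c : ℂ} (hc : c ^ 24 = 1)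
    (hd : ∀ z : ℂ, 0 < z.im → DifferentiableAt ℂ h z)
    (hT : ∀ z : ℂ, h (z + 2) = c * h z) (hS : ∀ z : ℂ, 0 < z.im → h (-1 / z) = h z)
    (h0 : Tendsto h I∞ (𝓝 0)) (h1 : BoundedAtFilter I∞ fun z => h (1 + -1 / z))
    {z : ℂ} (hz : 0 < z.im) : h z = 0 := by
  have him1 : ∀ z : ℂ, 0 < z.im → 0 < (z + 1).im := fun z hz => by simpa using hz
  have himS : ∀ z : ℂ, 0 < z.im → 0 < (1 + -1 / z).im := fun z hz => by
    simpa using im_neg_one_div_pos hz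
  have hd1 : ∀ z : ℂ, 0 < z.im → DifferentiableAt ℂ (fun z => h (z + 1)) z := fun z hz =>
    (hd _ (him1 z hz)).comp z (f := fun z : ℂ => z + 1) (by fun_prop)
  have hd2 : ∀ z : ℂ, 0 < z.im → DifferentiableAt ℂ (fun z => h (1 + -1 / z)) z := fun z hz =>
    (hd _ (himS z hz)).comp z (f := fun z : ℂ => 1 + -1 / z)
      (((differentiableAt_const _).div differentiableAt_id (ne_zero_of_im_pos hz)).const_add _)
  -- This is the norm over the three cosets of the theta group. Level-one generators permute the
  -- factors up to powers of `c`, which the 24th power removes.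
  have key : ∀ z : ℂ, 0 < z.im → (h z * h (z + 1) * h (1 + -1 / z)) ^ 24 = 0 := by
    intro z hz
    refine eq_zero_of_levelOne (G := fun z => (h z * h (z + 1) * h (1 + -1 / z)) ^ 24)
      (fun z hz => (((hd z hz).mul (hd1 z hz)).mul (hd2 z hz)).pow 24) (fun z hz => ?_)
      (fun z hz => ?_) ?_ hz
    · have hz0 := ne_zero_of_im_pos hz
      have hz1 := ne_zero_of_im_pos (him1 z hz)
      have hw : 0 < (-1 / z - 1).im := by simpa using im_neg_one_div_pos hz
      have e1 : 1 + -1 / (z + 1) = -1 / (-1 / z - 1) := by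
        have : -1 / z - 1 = -(z + 1) / z := by field_simp; ring
        rw [this]
        field_simp
        ring
      have e2 : h (1 + -1 / z) = c * h (-1 / z - 1) := by
        rw [← hT]; congr 1; ring
      have e3 : z + 1 + 1 = z + 2 := by ring
      rw [e1, hS _ hw, e2, e3, hT]
      simp only [mul_pow, hc]
      ring
    · have hz0 := ne_zero_of_im_pos hz
      have e1 : 1 + -1 / (-1 / z) = z + 1 := by field_simp; ring
      rw [e1, hS z hz, add_comm (-1 / z)]
      ring
    · have hb : Tendsto (fun z => h z * h (z + 1)) I∞ (𝓝 0) := by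
        simpa using h0.mul (h0.comp (tendsto_im_add 1))
      have := (ZeroAtFilter.mul_boundedAtFilter hb h1).pow 24
      simpa using this
  have key2 : ∀ z : ℂ, 0 < z.im → (h z * h (z + 1)) * h (1 + -1 / z) = 0 := fun z hz =>
    pow_eq_zero_iff (by norm_num) |>.mp (key z hz)
  rcases eq_zero_or_eq_zero_of_mul_eq_zero (fun z hz => (hd z hz).mul (hd1 z hz)) hd2 key2
    with h3 | h3
  · rcases eq_zero_or_eq_zero_of_mul_eq_zero hd hd1 h3 with h4 | h4
    · exact h4 z hz
    · have := h4 (z - 1) (by simpa using hz)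
      simpa using this
  · have hw : 0 < (z - 1).im := by simpa using hz
    have := h3 _ (im_neg_one_div_pos hw)
    have hw0 := ne_zero_of_im_pos hw
    have e : 1 + -1 / (-1 / (z - 1)) = z := by field_simp; ring
    rwa [e] at this

lemma qParam_add_two (z : ℂ) : qParam 48 (z + 2) = zeta24 * qParam 48 z := by
  rw [qParam_add, mul_comm]
  congr 1
  rw [qParam, zeta24]
  congr 1
  push_cast
  ring

lemma apply_add_two_mul {h : ℂ → ℂ} {c : ℂ} (hT : ∀ z : ℂ, h (z + 2) = c * h z) (n : ℕ) (z : ℂ) :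
    h (z + 2 * n) = c ^ n * h z := by
  induction n with
  | zero => simp
  | succ n ih =>
    have : z + 2 * ((n + 1 : ℕ) : ℂ) = z + 2 * n + 2 := by push_cast; ring
    rw [this, hT, ih, pow_succ]
    ring

/-- `L` is the constant term of the 48-periodic function `q^N h`. The condition on `L` says that `L
𝔣^N` has the same character as `h`, so subtracting it stays within the same class of functions. -/
lemma exists_leading_coeff (N : ℕ) {h : ℂ → ℂ} {c : ℂ} (hc : c ^ 24 = 1)
    (hd : ∀ z : ℂ, 0 < z.im → DifferentiableAt ℂ h z) (hT : ∀ z : ℂ, h (z + 2) = c * h z)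
    (h0 : BoundedAtFilter I∞ fun z => qParam 48 z ^ N * h z) :
    ∃ L : ℂ, L * zeta24⁻¹ ^ N = c * L ∧
      Tendsto (fun z => qParam 48 z ^ N * (h z - L * weberF z ^ N)) I∞ (𝓝 0) := by
  have hper : Function.Periodic (fun z => qParam 48 z ^ N * h z) ((48 : ℝ) : ℂ) := by
    intro z
    have e : z + ((48 : ℝ) : ℂ) = z + 2 * (24 : ℕ) := by push_cast; ring
    have hq : qParam 48 (z + 2 * (24 : ℕ)) = qParam 48 z := by
      rw [apply_add_two_mul qParam_add_two, zeta24_pow, one_mul]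
    simp only [e, hq, apply_add_two_mul hT, hc, one_mul]
  have hlim := tendsto_at_I_inf (by norm_num) hper
    (eventually_im_pos.mono fun z hz => ((differentiable_qParam z).pow N).mul (hd z hz)) h0
  set L := cuspFunction 48 (fun z => qParam 48 z ^ N * h z) 0
  refine ⟨L, ?_, ?_⟩
  · have h2 := hlim.comp (tendsto_im_add 2)
    have h3 := hlim.const_mul (zeta24 ^ N * c)
    have h4 := tendsto_nhds_unique h2 (h3.congr fun z => by
      simp only [Function.comp, qParam_add_two, hT]; ring)
    have := pow_ne_zero N zeta24_ne_zero
    rw [inv_pow]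
    field_simp
    linear_combination h4
  · have h2 := hlim.sub ((tendsto_qParam_mul_weberF.pow N).const_mul L)
    simp only [one_pow, mul_one, sub_self] at h2
    exact h2.congr fun z => by rw [mul_pow]; ring

/-- The Weber function generates the ring of holomorphic functions which transform under the theta
group by a character of order dividing `24`, are bounded at the cusp `1` and meromorphic at
infinity. -/
lemma exists_polynomial_of_thetaGroup (N : ℕ) {h : ℂ → ℂ} {c : ℂ} (hc : c ^ 24 = 1)
    (hd : ∀ z : ℂ, 0 < z.im → DifferentiableAt ℂ h z)
    (hT : ∀ z : ℂ, h (z + 2) = c * h z) (hS : ∀ z : ℂ, 0 < z.im → h (-1 / z) = h z)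
    (h0 : BoundedAtFilter I∞ fun z => qParam 48 z ^ N * h z)
    (h1 : BoundedAtFilter I∞ fun z => h (1 + -1 / z)) :
    ∃ p : Polynomial ℂ, ∀ z : ℂ, 0 < z.im → h z = p.eval (weberF z) := by
  have hsub : ∀ (L : ℂ) (M : ℕ), L * zeta24⁻¹ ^ M = c * L → ∀ {h : ℂ → ℂ},
      (∀ z : ℂ, h (z + 2) = c * h z) →
      ∀ z : ℂ, h (z + 2) - L * weberF (z + 2) ^ M = c * (h z - L * weberF z ^ M) := by
    intro L M hL h hT z
    rw [hT, weberF_add_two, mul_pow]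
    linear_combination (-weberF z ^ M) * hL
  have hdiff : ∀ (L : ℂ) (M : ℕ) {h : ℂ → ℂ}, (∀ z : ℂ, 0 < z.im → DifferentiableAt ℂ h z) →
      ∀ z : ℂ, 0 < z.im → DifferentiableAt ℂ (fun z => h z - L * weberF z ^ M) z :=
    fun L M h hd z hz => (hd z hz).sub (((differentiableAt_weberF hz).pow M).const_mul L)
  have hinv : ∀ (L : ℂ) (M : ℕ) {h : ℂ → ℂ}, (∀ z : ℂ, 0 < z.im → h (-1 / z) = h z) →
      ∀ z : ℂ, 0 < z.im → h (-1 / z) - L * weberF (-1 / z) ^ M = h z - L * weberF z ^ M :=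
    fun L M h hS z hz => by rw [hS z hz, weberF_S hz]
  have hcusp : ∀ (L : ℂ) (M : ℕ) {h : ℂ → ℂ}, (BoundedAtFilter I∞ fun z => h (1 + -1 / z)) →
      BoundedAtFilter I∞ fun z => h (1 + -1 / z) - L * weberF (1 + -1 / z) ^ M := by
    intro L M h h1
    have h2 : (fun z => L * weberF (1 + -1 / z) ^ M) =O[I∞] (fun _ => (1 : ℝ)) :=
      ((tendsto_weberF_cusp_one.pow M).const_mul L).isBigO_one ℝ
    exact IsBigO.sub h1 h2
  induction N generalizing h with
  | zero =>
    obtain ⟨L, hL, hlim⟩ := exists_leading_coeff 0 hc hd hT h0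
    refine ⟨Polynomial.C L, fun z hz => ?_⟩
    have := eq_zero_of_thetaGroup hc (hdiff L 0 hd) (hsub L 0 hL hT) (hinv L 0 hS)
      (by simpa using hlim) (hcusp L 0 h1) hz
    simpa [sub_eq_zero] using this
  | succ N ih =>
    obtain ⟨L, hL, hlim⟩ := exists_leading_coeff (N + 1) hc hd hT h0
    have hper : Function.Periodic (fun z => qParam 48 z ^ (N + 1) * (h z - L * weberF z ^ (N + 1)))
        ((48 : ℝ) : ℂ) := by
      intro z
      have e : z + ((48 : ℝ) : ℂ) = z + 2 * (24 : ℕ) := by push_cast; ring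
      have hq : qParam 48 (z + 2 * (24 : ℕ)) = qParam 48 z := by
        rw [apply_add_two_mul qParam_add_two, zeta24_pow, one_mul]
      have hh := apply_add_two_mul (h := fun z => h z - L * weberF z ^ (N + 1))
        (hsub L (N + 1) hL hT) 24 z
      beta_reduce at hh
      simp only [e, hq, hh, hc, one_mul]
    -- Vanishing at `i∞` improves to `O(q)`; cancelling one `q` lowers the pole order for the
    -- induction.
    have hdecay := exp_decay_of_zero_at_inf (by norm_num) hper
      (eventually_im_pos.mono fun z hz =>
        ((differentiable_qParam z).pow (N + 1)).mul (hdiff L (N + 1) hd z hz)) hlim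
    have hb : BoundedAtFilter I∞ fun z => qParam 48 z ^ N * (h z - L * weberF z ^ (N + 1)) := by
      obtain ⟨C, hC⟩ := hdecay.bound
      refine IsBigO.of_bound C ?_
      filter_upwards [hC] with z hz
      have hq0 : 0 < ‖qParam 48 z‖ := norm_pos_iff.mpr (qParam_ne_zero z)
      rw [← norm_qParam, norm_norm, pow_succ', mul_assoc, norm_mul, mul_comm C] at hz
      simpa using le_of_mul_le_mul_left hz hq0
    obtain ⟨p, hp⟩ := ih (hdiff L (N + 1) hd) (hsub L (N + 1) hL hT) (hinv L (N + 1) hS) hb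
      (hcusp L (N + 1) h1)
    refine ⟨p + Polynomial.C L * Polynomial.X ^ (N + 1), fun z hz => ?_⟩
    simp [← hp z hz]

/-! ### The monic polynomial of the conjugates. -/

lemma coeff_prod_mem {ι : Type*} (s : Finset ι) (A : Subring (ℂ → ℂ)) (f : ι → ℂ → ℂ)
    (hf : ∀ i ∈ s, f i ∈ A) (n : ℕ) :
    (fun z => (∏ i ∈ s, (Polynomial.X - Polynomial.C (f i z))).coeff n) ∈ A := by
  classical
  induction s using Finset.induction_on generalizing n with
  | empty =>
    simp only [Finset.prod_empty, Polynomial.coeff_one]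
    split_ifs
    · exact A.one_mem
    · exact A.zero_mem
  | insert i s hi ih =>
    have ih' := fun n => ih (fun j hj => hf j (Finset.mem_insert_of_mem hj)) n
    have hi' := hf i (Finset.mem_insert_self i s)
    have h1 := A.mul_mem hi' (ih' n)
    simp only [Finset.prod_insert hi, sub_mul]
    cases n with
    | zero =>
      convert A.neg_mem h1 using 1
      ext z
      simp
    | succ n =>
      convert A.sub_mem (ih' n) h1 using 1
      ext z
      simp

/-- Multiplying by `c ^ n` on the left avoids the exponent `s.card - n`. -/
lemma coeff_prod_smul {ι : Type*} (s : Finset ι) (f : ι → ℂ) {c : ℂ} (n : ℕ) :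
    (∏ i ∈ s, (Polynomial.X - Polynomial.C (c * f i))).coeff n * c ^ n =
      c ^ s.card * (∏ i ∈ s, (Polynomial.X - Polynomial.C (f i))).coeff n := by
  rw [← Polynomial.comp_C_mul_X_coeff, Polynomial.prod_comp, ← Polynomial.coeff_C_mul,
    ← Finset.prod_const, map_prod, ← Finset.prod_mul_distrib]
  congr 1
  refine Finset.prod_congr rfl fun i _ => ?_
  simp [mul_sub]

/-- The subring of functions holomorphic on the upper half-plane. -/
def holomorphicSubring : Subring (ℂ → ℂ) where
  carrier := {g | ∀ z : ℂ, 0 < z.im → DifferentiableAt ℂ g z}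
  mul_mem' hf hg z hz := (hf z hz).mul (hg z hz)
  one_mem' _ _ := differentiableAt_const _
  add_mem' hf hg z hz := (hf z hz).add (hg z hz)
  zero_mem' _ _ := differentiableAt_const _
  neg_mem' hf z hz := (hf z hz).neg

/-- The subring of functions which are bounded at the cusp `1`. -/
def boundedAtOneSubring : Subring (ℂ → ℂ) where
  carrier := {g | BoundedAtFilter I∞ fun z => g (1 + -1 / z)}
  mul_mem' hf hg := BoundedAtFilter.mul hf hg
  one_mem' := const_boundedAtFilter _ _
  add_mem' hf hg := BoundedAtFilter.add hf hg
  zero_mem' := const_boundedAtFilter _ _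
  neg_mem' hf := BoundedAtFilter.neg hf

lemma boundedAtFilter_qParam_pow (N : ℕ) : BoundedAtFilter I∞ fun z => qParam 48 z ^ N :=
  ((tendsto_qParam_zero (h := 48) (by norm_num)).pow N).isBigO_one ℝ

/-- The subring of functions which are meromorphic at infinity. -/
def moderateSubring : Subring (ℂ → ℂ) where
  carrier := {g | ∃ N : ℕ, BoundedAtFilter I∞ fun z => qParam 48 z ^ N * g z}
  mul_mem' := by
    rintro f g ⟨M, hf⟩ ⟨N, hg⟩
    refine ⟨M + N, (BoundedAtFilter.mul hf hg).congr_left fun z => ?_⟩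
    simp only [Pi.mul_apply, pow_add]
    ring
  one_mem' := ⟨0, by simpa using! const_boundedAtFilter _ _⟩
  add_mem' := by
    rintro f g ⟨M, hf⟩ ⟨N, hg⟩
    refine ⟨M + N, (BoundedAtFilter.add (BoundedAtFilter.mul (boundedAtFilter_qParam_pow N) hf)
      (BoundedAtFilter.mul (boundedAtFilter_qParam_pow M) hg)).congr_left fun z => ?_⟩
    simp only [Pi.mul_apply, Pi.add_apply, pow_add]
    ring
  zero_mem' := ⟨0, by simpa using! const_boundedAtFilter _ _⟩
  neg_mem' := by
    rintro f ⟨M, hf⟩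
    exact ⟨M, (BoundedAtFilter.neg hf).congr_left fun z => by simp⟩

/-- The monic polynomial whose roots are the values of the `ℓ + 1` conjugates. -/
def conjPoly (ℓ : ℕ) [NeZero ℓ] (z : ℂ) : Polynomial ℂ :=
  ∏ i : Option (ZMod ℓ), (Polynomial.X - Polynomial.C (weberConj ℓ i z))

lemma conjPoly_monic (ℓ : ℕ) [NeZero ℓ] (z : ℂ) : (conjPoly ℓ z).Monic :=
  Polynomial.monic_prod_of_monic _ _ fun _ _ => Polynomial.monic_X_sub_C _

lemma card_option_zmod (ℓ : ℕ) [NeZero ℓ] :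
    (Finset.univ : Finset (Option (ZMod ℓ))).card = ℓ + 1 := by
  simp [ZMod.card]

lemma natDegree_conjPoly (ℓ : ℕ) [NeZero ℓ] (z : ℂ) : (conjPoly ℓ z).natDegree = ℓ + 1 := by
  rw [conjPoly, Polynomial.natDegree_prod_of_monic _ _ fun _ _ => Polynomial.monic_X_sub_C _]
  simp [ZMod.card]

lemma conjPoly_S {ℓ : ℕ} [Fact ℓ.Prime] (h48 : ℓ.Coprime 48) {z : ℂ} (hz : 0 < z.im) :
    conjPoly ℓ (-1 / z) = conjPoly ℓ z := by
  simp only [conjPoly, weberConj_S h48 _ hz]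
  exact Equiv.prod_comp (permS_involutive h48).toPerm
    fun i => Polynomial.X - Polynomial.C (weberConj ℓ i z)

lemma coeff_conjPoly_add_two {ℓ : ℕ} [NeZero ℓ] (h48 : ℓ.Coprime 48) (n : ℕ) (z : ℂ) :
    (conjPoly ℓ (z + 2)).coeff n =
      ((zeta24 ^ ℓ)⁻¹ ^ (ℓ + 1) * (zeta24 ^ ℓ) ^ n) * (conjPoly ℓ z).coeff n := by
  have h := coeff_prod_smul Finset.univ (fun i => weberConj ℓ (permT ℓ i) z)
    (c := (zeta24 ^ ℓ)⁻¹) n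
  rw [card_option_zmod] at h
  simp only [conjPoly, weberConj_add_two h48]
  rw [← Equiv.prod_comp (permT ℓ) fun i => Polynomial.X - Polynomial.C (weberConj ℓ i z),
    mul_right_comm, ← h]
  have : (zeta24 ^ ℓ) ^ n ≠ 0 := pow_ne_zero _ (pow_ne_zero _ zeta24_ne_zero)
  rw [inv_pow, inv_mul_cancel_right₀ this]

lemma exists_polynomial_coeff_conjPoly {ℓ : ℕ} [Fact ℓ.Prime] (h48 : ℓ.Coprime 48) (n : ℕ) :
    ∃ p : Polynomial ℂ, ∀ z : ℂ, 0 < z.im → (conjPoly ℓ z).coeff n = p.eval (weberF z) := by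
  obtain ⟨N, hN⟩ : (fun z => (conjPoly ℓ z).coeff n) ∈ moderateSubring := by
    refine coeff_prod_mem _ moderateSubring _ (fun i _ => ⟨ℓ, ?_⟩) n
    rcases i with _ | k
    · exact tendsto_weberConj_none.isBigO_one ℝ
    · exact (tendsto_weberConj_some_zero (Fact.out : ℓ.Prime).one_lt k).isBigO_one ℝ
  refine exists_polynomial_of_thetaGroup N (c := (zeta24 ^ ℓ)⁻¹ ^ (ℓ + 1) * (zeta24 ^ ℓ) ^ n) ?_ ?_
    (coeff_conjPoly_add_two h48 n) (fun z hz => by rw [conjPoly_S h48 hz]) hN ?_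
  · have h := zeta24_pow
    rw [mul_pow, ← pow_mul, ← pow_mul, ← pow_mul, inv_pow, ← pow_mul]
    have e : ∀ k : ℕ, zeta24 ^ (k * 24) = 1 := fun k => by rw [mul_comm, pow_mul, h, one_pow]
    rw [← mul_assoc, e, ← mul_assoc, e]
    simp
  · exact coeff_prod_mem _ holomorphicSubring _
      (fun i _ z hz => differentiableAt_weberConj i hz) n
  · exact coeff_prod_mem _ boundedAtOneSubring _
      (fun i _ => (tendsto_weberConj_cusp_one h48 i).isBigO_one ℝ) n

/-- The bivariate polynomial `∏ (Y - 𝔣ᵢ)` over the conjugates `𝔣ᵢ` of `𝔣(ℓτ)`, with coefficients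
polynomials in `𝔣(τ)`. -/
lemma exists_bivariate_conjPoly {ℓ : ℕ} [Fact ℓ.Prime] (h48 : ℓ.Coprime 48) :
    ∃ F : Polynomial (Polynomial ℂ), F.Monic ∧ F.natDegree = ℓ + 1 ∧
      ∀ z : ℂ, 0 < z.im → F.map (Polynomial.evalRingHom (weberF z)) = conjPoly ℓ z := by
  choose p hp using exists_polynomial_coeff_conjPoly (ℓ := ℓ) h48
  -- The top coefficient is inserted separately as `X ^ (ℓ + 1)`, so that monicity does not depend
  -- on the choice of `p (ℓ + 1)`.
  set R : Polynomial (Polynomial ℂ) :=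
    ∑ n ∈ Finset.range (ℓ + 1), Polynomial.C (p n) * Polynomial.X ^ n with hR
  have hdeg : R.degree < ((ℓ + 1 : ℕ) : WithBot ℕ) := by
    refine (Polynomial.degree_sum_le _ _).trans_lt ?_
    rw [Finset.sup_lt_iff (WithBot.bot_lt_coe _)]
    intro n hn
    exact (Polynomial.degree_C_mul_X_pow_le _ _).trans_lt
      (by exact_mod_cast Finset.mem_range.mp hn)
  refine ⟨Polynomial.X ^ (ℓ + 1) + R, Polynomial.monic_X_pow_add hdeg,
    Polynomial.natDegree_eq_of_degree_eq_some ?_, fun z hz => ?_⟩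
  · rw [Polynomial.degree_add_eq_left_of_degree_lt (by rwa [Polynomial.degree_X_pow]),
      Polynomial.degree_X_pow]
  · have h := (conjPoly ℓ z).as_sum_range
    rw [natDegree_conjPoly, Finset.sum_range_succ] at h
    have h1 : (conjPoly ℓ z).coeff (ℓ + 1) = 1 := by
      rw [← natDegree_conjPoly ℓ z]; exact conjPoly_monic ℓ z
    rw [h, h1, Polynomial.map_add, add_comm, hR, Polynomial.map_sum]
    congr 1
    · refine Finset.sum_congr rfl fun n _ => ?_
      simp [hp n z hz, ← Polynomial.C_mul_X_pow_eq_monomial]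
    · simp [Polynomial.X_pow_eq_monomial]

/-! ### Relations and their minimal degree. -/

/-- The bivariate polynomial `Q` satisfies `Q(𝔣(τ), 𝔣(ℓτ)) = 0` on the upper half-plane. -/
def IsWeberRelation (ℓ : ℕ) (Q : Polynomial (Polynomial ℂ)) : Prop :=
  ∀ z : ℂ, 0 < z.im → Q.evalEval (weberF z) (weberF (ℓ * z)) = 0

lemma isWeberRelation_of_map_eq {ℓ : ℕ} [NeZero ℓ] {F : Polynomial (Polynomial ℂ)}
    (hF : ∀ z : ℂ, 0 < z.im → F.map (Polynomial.evalRingHom (weberF z)) = conjPoly ℓ z) :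
    IsWeberRelation ℓ F := by
  intro z hz
  rw [← Polynomial.map_evalRingHom_eval, hF z hz, conjPoly, Polynomial.eval_prod]
  exact Finset.prod_eq_zero (Finset.mem_univ none) (by simp [weberConj])

/-- The inversion reaches `some 0` from `none`; then `z ↦ z + 48` fixes `𝔣(z)` and moves `k` to `k +
1`. -/
lemma IsWeberRelation.weberConj {ℓ : ℕ} [Fact ℓ.Prime] (h48 : ℓ.Coprime 48)
    {Q : Polynomial (Polynomial ℂ)} (hQ : IsWeberRelation ℓ Q) (i : Option (ZMod ℓ)) :
    ∀ z : ℂ, 0 < z.im → Q.evalEval (weberF z) (weberConj ℓ i z) = 0 := by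
  have key : ∀ n : ℕ, ∀ z : ℂ, 0 < z.im →
      Q.evalEval (weberF z) (WeberModular.weberConj ℓ (some (n : ZMod ℓ)) z) = 0 := by
    intro n
    induction n with
    | zero =>
      intro z hz
      have h := hQ _ (im_neg_one_div_pos hz)
      rw [weberF_S hz] at h
      have e := weberConj_S h48 none hz
      simp only [permS] at e
      rw [Nat.cast_zero, ← e]
      exact h
    | succ n ih =>
      intro z hz
      have h := ih (z + 48) (by simpa using hz)
      have e : weberF (z + 48) = weberF z := by
        have := weberF_add_int_of_dvd (m := 48) (dvd_refl _) z
        exact_mod_cast this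
      rw [e, weberConj_add_fortyeight] at h
      simpa using h
  rcases i with _ | k
  · exact hQ
  · simpa using key k.val

lemma tendsto_weberF_cobounded : Tendsto weberF I∞ (Bornology.cobounded ℂ) := by
  have hq := tendsto_inv₀_nhdsNE_zero.comp (qParam_tendsto (h := 48) (by norm_num))
  have h1 : Tendsto (fun z => ‖(qParam 48 z)⁻¹‖) I∞ atTop :=
    tendsto_norm_atTop_iff_cobounded.mpr hq
  rw [← tendsto_norm_atTop_iff_cobounded]
  have h3 := tendsto_qParam_mul_weberF.norm
  rw [norm_one] at h3
  have h2 := h1.atTop_mul_pos one_pos h3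
  refine h2.congr fun z => ?_
  rw [← norm_mul, inv_mul_cancel_left₀ (qParam_ne_zero z)]

lemma eventually_eval_weberF_ne_zero {p : Polynomial ℂ} (hp : p ≠ 0) :
    ∀ᶠ z in I∞, p.eval (weberF z) ≠ 0 := by
  have h : ∀ᶠ x in Bornology.cobounded ℂ, ¬ x ∈ {x | p.IsRoot x} :=
    (Polynomial.finite_setOfPred_isRoot hp).isBounded
  exact tendsto_weberF_cobounded.eventually h

/-- There is no nontrivial relation of degree at most `ℓ` in the second variable. -/
lemma IsWeberRelation.eq_zero {ℓ : ℕ} [Fact ℓ.Prime] (h48 : ℓ.Coprime 48)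
    {Q : Polynomial (Polynomial ℂ)} (hQ : IsWeberRelation ℓ Q) (hdeg : Q.natDegree ≤ ℓ) :
    Q = 0 := by
  by_contra hne
  have hlc := eventually_eval_weberF_ne_zero (Polynomial.leadingCoeff_ne_zero.mpr hne)
  obtain ⟨z, h1, hinj, hz⟩ := (hlc.and ((eventually_injective_weberConj (ℓ := ℓ)
    (Fact.out : ℓ.Prime).one_lt).and eventually_im_pos)).exists
  set P := Q.map (Polynomial.evalRingHom (weberF z)) with hP
  have hP0 : P ≠ 0 := by
    intro h0
    apply h1
    have := congrArg (fun p : Polynomial ℂ => p.coeff Q.natDegree) h0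
    simpa [hP] using this
  -- At a point high in the half-plane the specialised polynomial is nonzero but has `ℓ + 1`
  -- distinct roots.
  have hroots : (Finset.univ : Finset (Option (ZMod ℓ))).card ≤ P.natDegree := by
    refine (Finset.card_le_card_of_injOn (t := P.roots.toFinset)
      (fun i => WeberModular.weberConj ℓ i z) (fun i _ => ?_) hinj.injOn).trans
      ((Multiset.toFinset_card_le _).trans (Polynomial.card_roots' P))
    simp only [Finset.mem_coe, Multiset.mem_toFinset, Polynomial.mem_roots hP0, Polynomial.IsRoot]
    rw [hP, Polynomial.map_evalRingHom_eval]
    exact hQ.weberConj h48 i z hz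
  rw [card_option_zmod] at hroots
  have := Polynomial.natDegree_map_le (f := Polynomial.evalRingHom (weberF z)) (p := Q)
  rw [← hP] at this
  omega

/-! ### Rationality through integral Taylor data. -/

lemma contDiffAt_zero_of_differentiableOn_ball {F : ℂ → ℂ}
    (hF : DifferentiableOn ℂ F (Metric.ball 0 1)) {n : ℕ} : ContDiffAt ℂ n F 0 :=
  (hF.analyticAt (Metric.ball_mem_nhds 0 one_pos)).contDiffAt

/-- The subring of functions, holomorphic on the unit disc, whose derivatives at `0` are
integers. -/
def integralSubring : Subring (ℂ → ℂ) where
  carrier := {F | DifferentiableOn ℂ F (Metric.ball 0 1) ∧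
    ∀ n, ∃ m : ℤ, iteratedDeriv n F 0 = m}
  mul_mem' := by
    rintro F G ⟨hF, hF'⟩ ⟨hG, hG'⟩
    refine ⟨hF.mul hG, fun n => ?_⟩
    choose a ha using hF'
    choose b hb using hG'
    rw [iteratedDeriv_mul (contDiffAt_zero_of_differentiableOn_ball hF)
      (contDiffAt_zero_of_differentiableOn_ball hG)]
    refine ⟨∑ i ∈ Finset.range (n + 1), n.choose i * a i * b (n - i), ?_⟩
    push_cast
    exact Finset.sum_congr rfl fun i _ => by rw [ha, hb]
  one_mem' := by
    refine ⟨differentiableOn_const _, fun n => ?_⟩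
    have : (1 : ℂ → ℂ) = fun _ => 1 := rfl
    rw [this, iteratedDeriv_const]
    split_ifs
    · exact ⟨1, by simp⟩
    · exact ⟨0, by simp⟩
  add_mem' := by
    rintro F G ⟨hF, hF'⟩ ⟨hG, hG'⟩
    refine ⟨hF.add hG, fun n => ?_⟩
    obtain ⟨a, ha⟩ := hF' n
    obtain ⟨b, hb⟩ := hG' n
    rw [iteratedDeriv_add (contDiffAt_zero_of_differentiableOn_ball hF)
      (contDiffAt_zero_of_differentiableOn_ball hG), ha, hb]
    exact ⟨a + b, by push_cast; rfl⟩
  zero_mem' := by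
    refine ⟨differentiableOn_const _, fun n => ⟨0, ?_⟩⟩
    have : (0 : ℂ → ℂ) = fun _ => 0 := rfl
    rw [this, iteratedDeriv_const]
    simp
  neg_mem' := by
    rintro F ⟨hF, hF'⟩
    refine ⟨hF.neg, fun n => ?_⟩
    obtain ⟨a, ha⟩ := hF' n
    exact ⟨-a, by rw [iteratedDeriv_neg, ha]; push_cast; rfl⟩

lemma pow_id_mem_integralSubring (k : ℕ) : (fun w : ℂ => w ^ k) ∈ integralSubring := by
  have h : (fun w : ℂ => w) ∈ integralSubring := by
    refine ⟨differentiableOn_id, fun n => ?_⟩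
    rw [iteratedDeriv_fun_id_zero]
    split_ifs
    · exact ⟨1, by simp⟩
    · exact ⟨0, by simp⟩
  exact integralSubring.pow_mem h k

/-- Derivatives converge locally uniformly and `ℤ` is closed in `ℂ`. This handles infinite products
without computing their coefficients. -/
lemma mem_integralSubring_of_tendsto {ι : Type*} {φ : Filter ι} [φ.NeBot] {F : ι → ℂ → ℂ}
    {G : ℂ → ℂ} (hF : ∀ i, F i ∈ integralSubring)
    (hG : TendstoLocallyUniformlyOn F G φ (Metric.ball 0 1)) : G ∈ integralSubring := by
  have hopen : IsOpen (Metric.ball (0 : ℂ) 1) := Metric.isOpen_ball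
  refine ⟨hG.differentiableOn (.of_forall fun i => (hF i).1) hopen, fun n => ?_⟩
  have key : TendstoLocallyUniformlyOn (fun i => iteratedDeriv n (F i)) (iteratedDeriv n G) φ
      (Metric.ball 0 1) ∧ ∀ i, DifferentiableOn ℂ (iteratedDeriv n (F i)) (Metric.ball 0 1) := by
    induction n with
    | zero => exact ⟨by simpa using hG, fun i => by simpa using (hF i).1⟩
    | succ n ih =>
      simp only [iteratedDeriv_succ]
      exact ⟨ih.1.deriv (.of_forall ih.2) hopen, fun i => (ih.2 i).deriv hopen⟩
  have hlim := key.1.tendsto_at (Metric.mem_ball_self one_pos)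
  have hcl : IsClosed (Set.range ((↑) : ℤ → ℂ)) := Complex.isClosedEmbedding_intCast.isClosed_range
  obtain ⟨m, hm⟩ := hcl.mem_of_tendsto hlim (.of_forall fun i => by
    obtain ⟨m, hm⟩ := (hF i).2 n
    exact ⟨m, hm.symm⟩)
  exact ⟨m, hm.symm⟩

lemma eulerProd_comp_mem_integralSubring {g : ℂ → ℂ} (hg : g ∈ integralSubring)
    (hmaps : Set.MapsTo g (Metric.ball 0 1) (Metric.ball 0 1)) :
    (fun w => eulerProd (g w)) ∈ integralSubring := by
  have h := ModularForm.multipliableLocallyUniformlyOn_one_sub_pow.hasProdLocallyUniformlyOn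
  have h2 := TendstoLocallyUniformlyOn.comp h g hmaps hg.1.continuousOn
  refine mem_integralSubring_of_tendsto (fun s => ?_) h2
  have h3 : ∏ i ∈ s, (1 - g ^ (i + 1)) ∈ integralSubring := integralSubring.prod_mem fun i _ =>
    integralSubring.sub_mem integralSubring.one_mem (integralSubring.pow_mem hg _)
  convert h3 using 1
  ext w
  simp

lemma iteratedDeriv_sum_const_mul {ι : Type*} (s : Finset ι) (c : ι → ℂ) {H : ι → ℂ → ℂ}
    (hH : ∀ i ∈ s, H i ∈ integralSubring) (n : ℕ) :
    iteratedDeriv n (fun w => ∑ i ∈ s, c i * H i w) 0 =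
      ∑ i ∈ s, c i * iteratedDeriv n (H i) 0 := by
  classical
  induction s using Finset.induction_on with
  | empty => simp
  | insert i s hi ih =>
    have hd : ∀ j ∈ insert i s, DifferentiableOn ℂ (fun w => c j * H j w) (Metric.ball 0 1) :=
      fun j hj => (hH j hj).1.const_mul _
    have hd2 : DifferentiableOn ℂ (fun w => ∑ j ∈ s, c j * H j w) (Metric.ball 0 1) :=
      DifferentiableOn.fun_sum fun j hj => hd j (Finset.mem_insert_of_mem hj)
    have e : (fun w => ∑ j ∈ insert i s, c j * H j w) =
        (fun w => c i * H i w) + fun w => ∑ j ∈ s, c j * H j w := by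
      ext w
      simp [Finset.sum_insert hi]
    rw [e, iteratedDeriv_add (contDiffAt_zero_of_differentiableOn_ball
      (hd i (Finset.mem_insert_self i s))) (contDiffAt_zero_of_differentiableOn_ball hd2),
      ih fun j hj => hH j (Finset.mem_insert_of_mem hj), Finset.sum_insert hi,
      iteratedDeriv_const_mul_field]

/-- A linear relation between functions with integral Taylor coefficients is preserved by applying a
`ℚ`-linear map to its coefficients. -/
lemma sum_eq_zero_of_linearMap {ι : Type*} (s : Finset ι) (c : ι → ℂ) {H : ι → ℂ → ℂ}
    (hH : ∀ i ∈ s, H i ∈ integralSubring) (φ : ℂ →ₗ[ℚ] ℚ)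
    (h : ∀ w : ℂ, w ≠ 0 → ‖w‖ < 1 → ∑ i ∈ s, c i * H i w = 0) {w : ℂ} (hw : ‖w‖ < 1) :
    ∑ i ∈ s, (φ (c i) : ℂ) * H i w = 0 := by
  have hd : ∀ c : ι → ℂ, DifferentiableOn ℂ (fun w => ∑ i ∈ s, c i * H i w) (Metric.ball 0 1) :=
    fun c => DifferentiableOn.fun_sum fun j hj => (hH j hj).1.const_mul _
  have hball := Metric.ball_mem_nhds (0 : ℂ) one_pos
  have h0 : ∑ i ∈ s, c i * H i 0 = 0 := by
    have h1 := ((hd c).continuousOn.continuousAt hball).tendsto.mono_left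
      (nhdsWithin_le_nhds (s := {0}ᶜ))
    refine tendsto_nhds_unique h1 (tendsto_const_nhds.congr' ?_)
    filter_upwards [self_mem_nhdsWithin, nhdsWithin_le_nhds hball] with w hw0 hw1
    exact (h w hw0 (by simpa using hw1)).symm
  have hev : (fun w => ∑ i ∈ s, c i * H i w) =ᶠ[𝓝 0] fun _ => 0 := by
    filter_upwards [hball] with w hw1
    rcases eq_or_ne w 0 with rfl | hw0
    · exact h0
    · exact h w hw0 (by simpa using hw1)
  -- Each derivative at `0` of the given relation is a linear relation among the `c i` with integer
  -- coefficients, which `φ` respects.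
  have hder : ∀ n, iteratedDeriv n (fun w => ∑ i ∈ s, (φ (c i) : ℂ) * H i w) 0 = 0 := by
    intro n
    have h1 := hev.iteratedDeriv_eq n
    rw [iteratedDeriv_sum_const_mul s c hH, iteratedDeriv_const, ite_self] at h1
    rw [iteratedDeriv_sum_const_mul s (fun i => (φ (c i) : ℂ)) hH]
    have hm : ∀ i : ι, ∃ m : ℤ, i ∈ s → iteratedDeriv n (H i) 0 = m := fun i => by
      by_cases hi : i ∈ s
      · obtain ⟨m, hm⟩ := (hH i hi).2 n
        exact ⟨m, fun _ => hm⟩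
      · exact ⟨0, fun h => absurd h hi⟩
    choose m hm using hm
    have h2 : ∑ i ∈ s, (m i : ℚ) • c i = 0 := by
      rw [← h1]
      refine Finset.sum_congr rfl fun i hi => ?_
      rw [hm i hi, Rat.smul_def, mul_comm]
      simp
    have h3 := congrArg φ h2
    rw [map_sum, map_zero] at h3
    have h4 := congrArg (Rat.cast : ℚ → ℂ) h3
    push_cast at h4
    refine Eq.trans ?_ h4
    refine Finset.sum_congr rfl fun i hi => ?_
    rw [hm i hi, map_smul]
    rw [smul_eq_mul]
    push_cast
    ring
  have hsum := Complex.hasSum_taylorSeries_on_ball (hd fun i => (φ (c i) : ℂ))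
    (z := w) (by simpa using hw)
  simp only [hder, smul_zero] at hsum
  exact hsum.unique hasSum_zero

lemma eulerProd_qParam_ne_zero {z : ℂ} (hz : 0 < z.im) : eulerProd (qParam 48 z ^ 48) ≠ 0 := by
  have h1 : qParam 1 z = qParam 48 z ^ 48 := by
    simp only [qParam, ← Complex.exp_nat_mul]
    congr 1; push_cast; ring
  rw [← h1]
  exact ModularForm.eta_tprod_ne_zero hz

lemma weber_relation_linearMap {ℓ : ℕ} [NeZero ℓ] (M : ℕ) (c : ℕ × ℕ → ℂ) (φ : ℂ →ₗ[ℚ] ℚ)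
    (h : ∀ z : ℂ, 0 < z.im → ∑ p ∈ Finset.range M ×ˢ Finset.range M,
      c p * (weberF z ^ p.1 * weberF (ℓ * z) ^ p.2) = 0) {z : ℂ} (hz : 0 < z.im) :
    ∑ p ∈ Finset.range M ×ˢ Finset.range M,
      (φ (c p) : ℂ) * (weberF z ^ p.1 * weberF (ℓ * z) ^ p.2) = 0 := by
  let A : ℂ → ℂ := fun w => eulerProd (-(w ^ 24))
  let B : ℂ → ℂ := fun w => w * eulerProd (w ^ 48)
  -- Here `𝔣 = A(q)/B(q)`; multiplying a relation by `B(q)^M B(q^ℓ)^M` clears all denominators, as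
  -- both exponents are below `M`.
  let H : ℕ × ℕ → ℂ → ℂ := fun p w => A w ^ p.1 * B w ^ (M - p.1) *
    (A (w ^ ℓ) ^ p.2 * B (w ^ ℓ) ^ (M - p.2))
  have hmaps : ∀ k : ℕ, k ≠ 0 →
      Set.MapsTo (fun w : ℂ => w ^ k) (Metric.ball 0 1) (Metric.ball 0 1) := fun k hk w hw => by
    simpa using pow_lt_one₀ (norm_nonneg w) (by simpa using hw) hk
  have hmaps' : ∀ k : ℕ, k ≠ 0 →
      Set.MapsTo (fun w : ℂ => -(w ^ k)) (Metric.ball 0 1) (Metric.ball 0 1) := fun k hk w hw => by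
    simpa using hmaps k hk hw
  have hA : ∀ k : ℕ, k ≠ 0 → (fun w => A (w ^ k)) ∈ integralSubring := by
    intro k hk
    simp only [A, ← pow_mul]
    exact eulerProd_comp_mem_integralSubring
      (integralSubring.neg_mem (pow_id_mem_integralSubring _)) (hmaps' _ (by positivity))
  have hB : ∀ k : ℕ, k ≠ 0 → (fun w => B (w ^ k)) ∈ integralSubring := by
    intro k hk
    simp only [B, ← pow_mul]
    exact integralSubring.mul_mem (pow_id_mem_integralSubring k)
      (eulerProd_comp_mem_integralSubring (pow_id_mem_integralSubring _) (hmaps _ (by positivity)))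
  have hH : ∀ p ∈ Finset.range M ×ˢ Finset.range M, H p ∈ integralSubring := by
    intro p _
    have hA1 := hA 1 one_ne_zero
    have hB1 := hB 1 one_ne_zero
    simp only [pow_one] at hA1 hB1
    have hℓ := NeZero.ne ℓ
    exact integralSubring.mul_mem
      (integralSubring.mul_mem (integralSubring.pow_mem hA1 _) (integralSubring.pow_mem hB1 _))
      (integralSubring.mul_mem (integralSubring.pow_mem (hA ℓ hℓ) _)
        (integralSubring.pow_mem (hB ℓ hℓ) _))
  have hB0 : ∀ z : ℂ, 0 < z.im → B (qParam 48 z) ≠ 0 := fun z hz =>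
    mul_ne_zero (qParam_ne_zero z) (eulerProd_qParam_ne_zero hz)
  have hf : ∀ z : ℂ, 0 < z.im → weberF z = A (qParam 48 z) / B (qParam 48 z) := fun z hz => by
    rw [weberF_eq]
    have h1 : qParam 48 z ≠ 0 := qParam_ne_zero z
    have h2 := eulerProd_qParam_ne_zero hz
    simp only [A, B]
    field_simp
  have hpow : ∀ {a b : ℂ} {i : ℕ}, b ≠ 0 → i < M → (a / b) ^ i * b ^ M = a ^ i * b ^ (M - i) := by
    intro a b i hb hi
    have h1 : (a / b) ^ i * b ^ i = a ^ i := by rw [← mul_pow, div_mul_cancel₀ _ hb]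
    rw [← h1, mul_assoc, ← pow_add, Nat.add_sub_cancel' hi.le]
  have key : ∀ (c : ℕ × ℕ → ℂ) (z : ℂ), 0 < z.im →
      (∑ p ∈ Finset.range M ×ˢ Finset.range M, c p * (weberF z ^ p.1 * weberF (ℓ * z) ^ p.2)) *
        (B (qParam 48 z) ^ M * B (qParam 48 z ^ ℓ) ^ M) =
      ∑ p ∈ Finset.range M ×ˢ Finset.range M, c p * H p (qParam 48 z) := by
    intro c z hz
    rw [Finset.sum_mul]
    refine Finset.sum_congr rfl fun p hp => ?_
    rw [Finset.mem_product, Finset.mem_range, Finset.mem_range] at hp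
    have hℓz := im_nat_mul_pos (NeZero.pos ℓ) hz
    have hb := hB0 _ hℓz
    rw [hf z hz, hf _ hℓz]
    rw [qParam_natCast_mul] at hb ⊢
    simp only [H]
    rw [← hpow (hB0 z hz) hp.1, ← hpow hb hp.2]
    ring
  have hrel : ∀ w : ℂ, w ≠ 0 → ‖w‖ < 1 →
      ∑ p ∈ Finset.range M ×ˢ Finset.range M, c p * H p w = 0 := by
    intro w hw0 hw1
    have hinv := im_invQParam_pos_of_norm_lt_one (h := 48) (by norm_num) hw1 hw0
    have := key c _ hinv
    rw [h _ hinv, zero_mul, qParam_right_inv (by norm_num) hw0] at this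
    exact this.symm
  have hfin := sum_eq_zero_of_linearMap _ c hH φ hrel (w := qParam 48 z)
    (norm_qParam_lt_one (by norm_num) hz)
  rw [← key (fun p => (φ (c p) : ℂ)) z hz] at hfin
  have hb := hB0 _ (im_nat_mul_pos (NeZero.pos ℓ) hz)
  rw [qParam_natCast_mul] at hb
  exact (mul_eq_zero.mp hfin).resolve_right
    (mul_ne_zero (pow_ne_zero _ (hB0 z hz)) (pow_ne_zero _ hb))

/-! ### From complex to rational and integral bivariate polynomials. -/

open Polynomial

lemma evalEval_eq_sum {K : Type*} [CommRing K] (Q : K[X][X]) {M : ℕ} (hM : Q.natDegree < M)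
    (hM' : ∀ j, (Q.coeff j).natDegree < M) (x y : K) :
    Q.evalEval x y = ∑ p ∈ Finset.range M ×ˢ Finset.range M,
      (Q.coeff p.2).coeff p.1 * (x ^ p.1 * y ^ p.2) := by
  rw [← map_evalRingHom_eval, eval_eq_sum_range' ((natDegree_map_le).trans_lt hM),
    Finset.sum_product_right]
  refine Finset.sum_congr rfl fun j _ => ?_
  rw [coeff_map, coe_evalRingHom, eval_eq_sum_range' (hM' j), Finset.sum_mul]
  exact Finset.sum_congr rfl fun i _ => by ring

lemma exists_natDegree_bound {K : Type*} [CommRing K] (Q : K[X][X]) :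
    ∃ M, Q.natDegree < M ∧ ∀ j, (Q.coeff j).natDegree < M := by
  refine ⟨Q.natDegree + (Finset.range (Q.natDegree + 1)).sup (fun j => (Q.coeff j).natDegree) + 1,
    by omega, fun j => ?_⟩
  by_cases hj : j ≤ Q.natDegree
  · have := Finset.le_sup (s := Finset.range (Q.natDegree + 1))
      (f := fun j => (Q.coeff j).natDegree) (Finset.mem_range.mpr (Nat.lt_succ_of_le hj))
    beta_reduce at this
    omega
  · rw [coeff_eq_zero_of_natDegree_lt (by omega), natDegree_zero]
    omega

/-- A bivariate polynomial with prescribed coefficients. -/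
lemma exists_bivariate_coeff {K L : Type*} [CommRing K] [CommRing L] (Q : K[X][X]) (φ : K → L)
    (hφ : φ 0 = 0) : ∃ R : L[X][X], ∀ i j, (R.coeff j).coeff i = φ ((Q.coeff j).coeff i) := by
  obtain ⟨M, hM, hM'⟩ := exists_natDegree_bound Q
  refine ⟨∑ j ∈ Finset.range M, monomial j (∑ i ∈ Finset.range M,
    monomial i (φ ((Q.coeff j).coeff i))), fun i j => ?_⟩
  by_cases hj : j < M
  · by_cases hi : i < M
    · simp [finsetSum_coeff, coeff_monomial, hj, hi]
    · rw [coeff_eq_zero_of_natDegree_lt (p := Q.coeff j) (by have := hM' j; omega), hφ]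
      simp [finsetSum_coeff, coeff_monomial, hj, hi]
  · rw [coeff_eq_zero_of_natDegree_lt (p := Q) (by omega), coeff_zero, hφ]
    simp [finsetSum_coeff, coeff_monomial, hj]

/-- The relation satisfied by `𝔣(τ)` and `𝔣(ℓτ)` has rational coefficients. -/
lemma exists_rational_relation {ℓ : ℕ} [Fact ℓ.Prime] (h48 : ℓ.Coprime 48) {F : ℂ[X][X]}
    (hF : IsWeberRelation ℓ F) (hmonic : F.Monic) (hdeg : F.natDegree = ℓ + 1) :
    ∃ R : ℚ[X][X], R.map (mapRingHom (algebraMap ℚ ℂ)) = F := by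
  -- A `ℚ`-linear retraction fixes `1`, so applying it to the coefficients keeps `F` monic. The
  -- difference from `F` then has degree at most `ℓ` and vanishes.
  obtain ⟨φ, hφ⟩ := LinearMap.exists_leftInverse_of_injective (Algebra.linearMap ℚ ℂ)
    (LinearMap.ker_eq_bot.mpr (algebraMap ℚ ℂ).injective)
  have hφ1 : φ 1 = 1 := by simpa using congrArg (fun f : ℚ →ₗ[ℚ] ℚ => f 1) hφ
  obtain ⟨R, hR⟩ := exists_bivariate_coeff F φ (map_zero φ)
  refine ⟨R, ?_⟩
  set S := R.map (mapRingHom (algebraMap ℚ ℂ)) with hS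
  have hSc : ∀ i j, (S.coeff j).coeff i = (φ ((F.coeff j).coeff i) : ℂ) := fun i j => by
    simp [hS, hR]
  have hSdeg : ∀ j, (S.coeff j).natDegree ≤ (F.coeff j).natDegree := fun j =>
    natDegree_le_iff_coeff_eq_zero.mpr fun i hi => by
      rw [hSc, coeff_eq_zero_of_natDegree_lt hi, map_zero, Rat.cast_zero]
  have hSdeg' : S.natDegree ≤ F.natDegree := natDegree_le_iff_coeff_eq_zero.mpr fun j hj => by
    ext i
    rw [hSc, coeff_eq_zero_of_natDegree_lt hj, coeff_zero, map_zero, Rat.cast_zero]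
  have hSrel : IsWeberRelation ℓ S := by
    obtain ⟨M, hM, hM'⟩ := exists_natDegree_bound F
    intro z hz
    rw [evalEval_eq_sum S (hSdeg'.trans_lt hM) fun j => (hSdeg j).trans_lt (hM' j)]
    simp only [hSc]
    refine weber_relation_linearMap M (fun p => (F.coeff p.2).coeff p.1) φ (fun z hz => ?_) hz
    rw [← evalEval_eq_sum F hM hM']
    exact hF z hz
  rw [← sub_eq_zero]
  refine IsWeberRelation.eq_zero h48 (fun z hz => ?_) ?_
  · rw [evalEval_sub, hSrel z hz, hF z hz, sub_zero]
  · rw [natDegree_le_iff_coeff_eq_zero]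
    intro j hj
    have h1 : F.coeff (ℓ + 1) = 1 := by rw [← hdeg]; exact hmonic
    rcases eq_or_lt_of_le (Nat.succ_le_of_lt hj) with rfl | hj'
    · ext i
      rw [coeff_sub, coeff_sub, hSc, Nat.succ_eq_add_one, h1, coeff_one, coeff_zero]
      split_ifs <;> simp [hφ1]
    · rw [coeff_sub, coeff_eq_zero_of_natDegree_lt (p := F) (by omega),
        coeff_eq_zero_of_natDegree_lt (p := S) (by omega), sub_zero]

lemma exists_int_mul_mem_map {A K : Type*} [CommRing A] [CommRing K] (ι : A →+* K)
    (h : ∀ a : K, ∃ N : ℤ, N ≠ 0 ∧ ∃ b, ι b = N * a) (p : K[X]) :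
    ∃ N : ℤ, N ≠ 0 ∧ ∃ q : A[X], q.map ι = (N : K[X]) * p := by
  induction p using Polynomial.induction_on' with
  | add p q hp hq =>
    obtain ⟨M, hM, p', hp'⟩ := hp
    obtain ⟨N, hN, q', hq'⟩ := hq
    refine ⟨M * N, mul_ne_zero hM hN, (N : A[X]) * p' + (M : A[X]) * q', ?_⟩
    rw [Polynomial.map_add, Polynomial.map_mul, Polynomial.map_mul, hp', hq',
      Polynomial.map_intCast, Polynomial.map_intCast]
    push_cast
    ring
  | monomial n a =>
    obtain ⟨N, hN, b, hb⟩ := h a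
    refine ⟨N, hN, monomial n b, ?_⟩
    rw [map_monomial, hb, ← C_mul_monomial, C_eq_intCast]

lemma exists_int_mul_mem_map_rat (R : ℚ[X][X]) :
    ∃ N : ℤ, N ≠ 0 ∧ ∃ P : ℤ[X][X],
      P.map (mapRingHom (Int.castRingHom ℚ)) = (N : ℚ[X][X]) * R := by
  refine exists_int_mul_mem_map _ (fun p => ?_) R
  refine exists_int_mul_mem_map (Int.castRingHom ℚ) (fun a => ⟨a.den, by simp, a.num, ?_⟩) p
  simp [mul_comm, Rat.mul_den_eq_num]

/-- The map between rings of bivariate polynomials induced by a map of coefficients. -/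
def bivariateMap {A K : Type*} [CommRing A] [CommRing K] (f : A →+* K) : A[X][X] →+* K[X][X] :=
  mapRingHom (mapRingHom f)

lemma bivariateMap_injective {A K : Type*} [CommRing A] [CommRing K] {f : A →+* K}
    (hf : Function.Injective f) : Function.Injective (bivariateMap f) :=
  map_injective _ (map_injective _ hf)

lemma bivariateMap_ratCast_intCast (P : ℤ[X][X]) :
    bivariateMap (algebraMap ℚ ℂ) (bivariateMap (Int.castRingHom ℚ) P) =
      bivariateMap (Int.castRingHom ℂ) P := by
  simp only [bivariateMap, coe_mapRingHom, Polynomial.map_map, mapRingHom_comp]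
  congr 2

lemma IsWeberRelation.mul_right {ℓ : ℕ} {P : ℂ[X][X]} (hP : IsWeberRelation ℓ P) (Q : ℂ[X][X]) :
    IsWeberRelation ℓ (P * Q) := fun z hz => by
  rw [evalEval_mul, hP z hz, zero_mul]

lemma IsWeberRelation.sub {ℓ : ℕ} {P Q : ℂ[X][X]} (hP : IsWeberRelation ℓ P)
    (hQ : IsWeberRelation ℓ Q) : IsWeberRelation ℓ (P - Q) := fun z hz => by
  rw [evalEval_sub, hP z hz, hQ z hz, sub_zero]

lemma exists_eq_mul_of_isWeberRelation {ℓ : ℕ} [Fact ℓ.Prime] (h48 : ℓ.Coprime 48) {R : ℚ[X][X]}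
    (hR : IsWeberRelation ℓ (bivariateMap (algebraMap ℚ ℂ) R)) (hmonic : R.Monic)
    (hdeg : R.natDegree = ℓ + 1) {P : ℚ[X][X]}
    (hP : IsWeberRelation ℓ (bivariateMap (algebraMap ℚ ℂ) P)) : ∃ G, P = R * G := by
  refine ⟨P /ₘ R, ?_⟩
  have hdiv := modByMonic_add_div P R
  suffices h : P %ₘ R = 0 by rw [h, zero_add] at hdiv; exact hdiv.symm
  refine bivariateMap_injective (algebraMap ℚ ℂ).injective ?_
  rw [map_zero]
  refine IsWeberRelation.eq_zero h48 ?_ ?_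
  · rw [eq_sub_of_add_eq hdiv, map_sub, map_mul]
    exact hP.sub (hR.mul_right _)
  · refine natDegree_map_le.trans ?_
    have := natDegree_modByMonic_lt P hmonic (by rintro rfl; simp at hdeg)
    omega

/-- An irreducible integral relation is a constant multiple of the monic relation. -/
lemma exists_eq_C_mul_of_irreducible {ℓ : ℕ} [Fact ℓ.Prime] (h48 : ℓ.Coprime 48) {R : ℚ[X][X]}
    (hR : IsWeberRelation ℓ (bivariateMap (algebraMap ℚ ℂ) R)) (hmonic : R.Monic)
    (hdeg : R.natDegree = ℓ + 1) {P : ℤ[X][X]} (hirr : Irreducible P)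
    (hP : IsWeberRelation ℓ (bivariateMap (Int.castRingHom ℂ) P)) :
    ∃ g : ℚ, bivariateMap (Int.castRingHom ℚ) P = C (C g) * R := by
  set ι := bivariateMap (Int.castRingHom ℚ) with hι
  have hinj : Function.Injective ι := bivariateMap_injective (RingHom.injective_int _)
  rw [← bivariateMap_ratCast_intCast] at hP
  obtain ⟨G, hG⟩ := exists_eq_mul_of_isWeberRelation h48 hR hmonic hdeg hP
  obtain ⟨N, hN, F', hF'⟩ := exists_int_mul_mem_map_rat R
  obtain ⟨M, hM, G', hG'⟩ := exists_int_mul_mem_map_rat G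
  change ι F' = _ at hF'
  change ι G' = _ at hG'
  have hprod : ((N * M : ℤ) : ℤ[X][X]) * P = F' * G' := hinj <| by
    rw [map_mul, map_mul, map_intCast, hF', hG', hG]
    push_cast
    ring
  have hNunit : IsUnit (N : ℚ[X][X]) := by
    have : (N : ℚ[X][X]) = C (C (N : ℚ)) := by simp
    rw [this, isUnit_C, isUnit_C]
    exact (Int.cast_ne_zero.mpr hN).isUnit
  have hprime : Prime P := hirr.prime
  -- If `P` divides `F'`, the cofactor `G` divides a nonzero constant, hence is a constant. If `P`
  -- divides `G'`, then `F'`, of degree `ℓ + 1` in `y`, would divide a nonzero integer.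
  rcases hprime.dvd_or_dvd (Dvd.intro_left _ hprod) with ⟨H, hH⟩ | ⟨H, hH⟩
  · have h1 : (N : ℚ[X][X]) = G * ι H := by
      refine mul_left_cancel₀ hmonic.ne_zero ?_
      rw [mul_comm, ← hF', hH, map_mul, hG, mul_assoc]
    have hGunit : IsUnit G := isUnit_of_mul_isUnit_left (h1 ▸ hNunit)
    obtain ⟨g, hg, rfl⟩ := isUnit_iff.mp hGunit
    obtain ⟨c, -, rfl⟩ := isUnit_iff.mp hg
    exact ⟨c, by rw [hG, mul_comm]⟩
  · exfalso
    have h1 : ((N * M : ℤ) : ℤ[X][X]) = F' * H := by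
      refine mul_right_cancel₀ hprime.ne_zero ?_
      rw [hprod, hH]
      ring
    have hne : ((N * M : ℤ) : ℤ[X][X]) ≠ 0 := by exact_mod_cast mul_ne_zero hN hM
    have hF'deg : F'.natDegree = ℓ + 1 := by
      rw [← natDegree_map_eq_of_injective (f := mapRingHom (Int.castRingHom ℚ))
        (map_injective _ (RingHom.injective_int _))]
      change (ι F').natDegree = _
      rw [hF', natDegree_mul hNunit.ne_zero hmonic.ne_zero, natDegree_intCast, hdeg, zero_add]
    have h2 := congrArg natDegree h1
    rw [h1] at hne
    rw [natDegree_intCast, natDegree_mul (left_ne_zero_of_mul hne) (right_ne_zero_of_mul hne)] at h2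
    omega

/-! ### The scaling symmetry. -/

/-- The substitution `x ↦ a x`, `y ↦ b y`. -/
def scaleHom (a b : ℂ) : ℂ[X][X] →+* ℂ[X][X] :=
  (compRingHom (C (C b) * X)).comp (mapRingHom (compRingHom (C a * X)))

lemma evalEval_scaleHom (a b x y : ℂ) (Q : ℂ[X][X]) :
    (scaleHom a b Q).evalEval x y = Q.evalEval (a * x) (b * y) := by
  have : (evalEvalRingHom x y).comp (scaleHom a b) = evalEvalRingHom (a * x) (b * y) := by
    ext <;> simp [scaleHom]
  exact congrArg (fun f : ℂ[X][X] →+* ℂ => f Q) this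

lemma coeff_scaleHom (a b : ℂ) (Q : ℂ[X][X]) (n : ℕ) :
    (scaleHom a b Q).coeff n = (Q.coeff n).comp (C a * X) * C b ^ n := by
  simp [scaleHom, comp_C_mul_X_coeff]

/-- With `ζ = zeta24 ^ k`, this is the original relation evaluated at `z - 2k`. -/
lemma isWeberRelation_scaleHom {ℓ : ℕ} {ζ : ℂ} (hζ : IsPrimitiveRoot ζ 24) {Q : ℂ[X][X]}
    (hQ : IsWeberRelation ℓ Q) : IsWeberRelation ℓ (scaleHom ζ (ζ ^ ℓ) Q) := fun z hz => by
  obtain ⟨k, -, rfl⟩ := zeta24_isPrimitiveRoot.eq_pow_of_pow_eq_one hζ.pow_eq_one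
  rw [evalEval_scaleHom]
  have h1 := weberF_add_two_mul_int (-k) z
  have h2 := weberF_add_two_mul_int (-(k * ℓ)) (ℓ * z)
  have h3 := hQ (z + 2 * ((-k : ℤ) : ℂ)) (by simpa using hz)
  rw [show (ℓ : ℂ) * (z + 2 * ((-k : ℤ) : ℂ)) = ℓ * z + 2 * ((-(k * ℓ) : ℤ) : ℂ) by
    push_cast; ring, h1, h2, neg_neg, neg_neg] at h3
  rw [← pow_mul]
  exact_mod_cast h3

lemma scaleHom_eq {ℓ : ℕ} [Fact ℓ.Prime] (h48 : ℓ.Coprime 48) {F : ℂ[X][X]}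
    (hF : IsWeberRelation ℓ F) (hmonic : F.Monic) (hdeg : F.natDegree = ℓ + 1)
    {ζ : ℂ} (hζ : IsPrimitiveRoot ζ 24) :
    scaleHom ζ (ζ ^ ℓ) F = C (C (ζ ^ (ℓ + 1))) * F := by
  rw [← sub_eq_zero]
  refine IsWeberRelation.eq_zero h48 ((isWeberRelation_scaleHom hζ hF).sub ?_) ?_
  · rw [mul_comm]
    exact hF.mul_right _
  · rw [natDegree_le_iff_coeff_eq_zero]
    intro j hj
    rw [coeff_sub, coeff_scaleHom, coeff_C_mul]
    -- In degree `ℓ + 1` the coefficients agree because `ℓ(ℓ + 1) ≡ ℓ + 1 mod 24`; this leaves a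
    -- relation of degree at most `ℓ`.
    rcases eq_or_lt_of_le (Nat.succ_le_of_lt hj) with rfl | hj'
    · have h1 : F.coeff (ℓ + 1) = 1 := by rw [← hdeg]; exact hmonic
      rw [Nat.succ_eq_add_one, h1, one_comp, one_mul, mul_one, ← C_pow, ← pow_mul, sub_eq_zero]
      congr 1
      have hsq := sq_eq_of_coprime h48
      obtain ⟨k, hk⟩ : ∃ k : ℕ, ((ℓ : ℤ) ^ 2 - 1) / 24 = k :=
        Int.eq_ofNat_of_zero_le (by have : (0 : ℤ) ≤ (ℓ : ℤ) ^ 2 := sq_nonneg _; omega)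
      rw [hk] at hsq
      have hsq' : ℓ ^ 2 = 1 + 24 * k := by exact_mod_cast hsq
      rw [show ℓ * (ℓ + 1) = (ℓ + 1) + 24 * k by rw [mul_add, ← sq, hsq']; ring, pow_add ζ, pow_mul,
        hζ.pow_eq_one, one_pow, mul_one]
    · rw [coeff_eq_zero_of_natDegree_lt (p := F) (by omega), zero_comp, zero_mul, mul_zero,
        sub_zero]

/-! ### Existence of an irreducible integral relation. -/

lemma differentiableAt_evalEval_weberF {ℓ : ℕ} [NeZero ℓ] (Q : ℂ[X][X]) {z : ℂ} (hz : 0 < z.im) :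
    DifferentiableAt ℂ (fun z => Q.evalEval (weberF z) (weberF (ℓ * z))) z := by
  obtain ⟨M, hM, hM'⟩ := exists_natDegree_bound Q
  simp only [evalEval_eq_sum Q hM hM']
  have h1 := differentiableAt_weberF hz
  have h2 : DifferentiableAt ℂ (fun w : ℂ => weberF (ℓ * w)) z :=
    (differentiableAt_weberF (im_nat_mul_pos (NeZero.pos ℓ) hz)).comp z (f := fun w : ℂ => ℓ * w)
      (by fun_prop)
  fun_prop

/-- The ideal of integral relations between `𝔣(τ)` and `𝔣(ℓτ)`. -/
def relationIdeal (ℓ : ℕ) : Ideal ℤ[X][X] where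
  carrier := {P | IsWeberRelation ℓ (bivariateMap (Int.castRingHom ℂ) P)}
  zero_mem' z _ := by rw [map_zero, evalEval_zero]
  add_mem' {P Q} hP hQ z hz := by rw [map_add, evalEval_add, hP z hz, hQ z hz, add_zero]
  smul_mem' c P hP := by
    rw [smul_eq_mul, mul_comm, Set.mem_ofPred_eq, map_mul]
    exact IsWeberRelation.mul_right hP _

lemma mem_relationIdeal {ℓ : ℕ} {P : ℤ[X][X]} :
    P ∈ relationIdeal ℓ ↔ IsWeberRelation ℓ (bivariateMap (Int.castRingHom ℂ) P) :=
  Iff.rfl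

/-- By the identity theorem, a product of holomorphic functions on the half-plane vanishes only if
one factor does. -/
instance isPrime_relationIdeal (ℓ : ℕ) [NeZero ℓ] : (relationIdeal ℓ).IsPrime where
  ne_top' h := by
    have h1 : (1 : ℤ[X][X]) ∈ relationIdeal ℓ := h ▸ Submodule.mem_top
    have h2 := mem_relationIdeal.mp h1 I (by simp)
    rw [map_one, evalEval_one] at h2
    exact one_ne_zero h2
  mem_or_mem' {P Q} hPQ := by
    refine eq_zero_or_eq_zero_of_mul_eq_zero (fun z hz => differentiableAt_evalEval_weberF _ hz)
      (fun z hz => differentiableAt_evalEval_weberF _ hz) fun z hz => ?_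
    rw [← evalEval_mul, ← map_mul]
    exact hPQ z hz

/-- The monic relation of degree `ℓ + 1` over the rational numbers. -/
lemma exists_monic_relation {ℓ : ℕ} [Fact ℓ.Prime] (h48 : ℓ.Coprime 48) :
    ∃ R : ℚ[X][X], IsWeberRelation ℓ (bivariateMap (algebraMap ℚ ℂ) R) ∧ R.Monic ∧
      R.natDegree = ℓ + 1 := by
  obtain ⟨F, hmonic, hdeg, hF⟩ := exists_bivariate_conjPoly h48
  have hrel := isWeberRelation_of_map_eq hF
  obtain ⟨R, hR⟩ := exists_rational_relation h48 hrel hmonic hdeg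
  have hinj : Function.Injective (mapRingHom (algebraMap ℚ ℂ)) :=
    map_injective _ (algebraMap ℚ ℂ).injective
  refine ⟨R, ?_, ?_, ?_⟩
  · change IsWeberRelation ℓ (R.map _)
    rwa [hR]
  · exact monic_of_injective hinj (hR ▸ hmonic)
  · rw [← natDegree_map_eq_of_injective hinj, hR, hdeg]

lemma exists_irreducible_relation {ℓ : ℕ} [Fact ℓ.Prime] (h48 : ℓ.Coprime 48) :
    ∃ P : ℤ[X][X], Irreducible P ∧ IsWeberRelation ℓ (bivariateMap (Int.castRingHom ℂ) P) := by
  obtain ⟨R, hR, hmonic, -⟩ := exists_monic_relation h48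
  obtain ⟨N, hN, P, hP⟩ := exists_int_mul_mem_map_rat R
  change bivariateMap (Int.castRingHom ℚ) P = _ at hP
  have hPmem : P ∈ relationIdeal ℓ := by
    rw [mem_relationIdeal, ← bivariateMap_ratCast_intCast, hP, mul_comm, map_mul]
    exact hR.mul_right _
  have hP0 : P ≠ 0 := by
    rintro rfl
    rw [map_zero] at hP
    exact mul_ne_zero (by exact_mod_cast hN) hmonic.ne_zero hP.symm
  -- A nonzero prime ideal of a factorial ring contains a prime element.
  obtain ⟨Φ, hΦ, hprime⟩ := (isPrime_relationIdeal ℓ).exists_mem_prime_of_ne_bot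
    fun h => hP0 (by rw [h] at hPmem; exact hPmem)
  exact ⟨Φ, hprime.irreducible, hΦ⟩

lemma scaleHom_bivariateMap_eq {ℓ : ℕ} [Fact ℓ.Prime] (h48 : ℓ.Coprime 48) {P : ℤ[X][X]}
    (hirr : Irreducible P) (hP : IsWeberRelation ℓ (bivariateMap (Int.castRingHom ℂ) P))
    {ζ : ℂ} (hζ : IsPrimitiveRoot ζ 24) :
    scaleHom ζ (ζ ^ ℓ) (bivariateMap (Int.castRingHom ℂ) P) =
      C (C (ζ ^ (ℓ + 1))) * bivariateMap (Int.castRingHom ℂ) P := by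
  obtain ⟨R, hR, hmonic, hdeg⟩ := exists_monic_relation h48
  obtain ⟨g, hg⟩ := exists_eq_C_mul_of_irreducible h48 hR hmonic hdeg hirr hP
  have hRdeg : (bivariateMap (algebraMap ℚ ℂ) R).natDegree = ℓ + 1 := by
    rw [← hdeg]
    exact natDegree_map_eq_of_injective (map_injective _ (algebraMap ℚ ℂ).injective) R
  have hscale := scaleHom_eq h48 hR (hmonic.map _) hRdeg hζ
  have hC : bivariateMap (algebraMap ℚ ℂ) (C (C g)) = C (C (g : ℂ)) := by simp [bivariateMap]
  have hC' : scaleHom ζ (ζ ^ ℓ) (C (C (g : ℂ))) = C (C (g : ℂ)) := by simp [scaleHom]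
  rw [← bivariateMap_ratCast_intCast, hg, map_mul, map_mul, hscale, hC, hC']
  ring

/-! ### Transfer to `MvPolynomial (Fin 2)`: the inner variable is `X 0`, the outer one `X 1`. -/

open Polynomial.Bivariate in
lemma aeval_equivMvPolynomial (P : ℤ[X][X]) (x y : ℂ) :
    MvPolynomial.aeval ![x, y] (equivMvPolynomial ℤ P) =
      (bivariateMap (Int.castRingHom ℂ) P).evalEval x y := by
  have : ((MvPolynomial.aeval ![x, y]).toRingHom : MvPolynomial (Fin 2) ℤ →+* ℂ).comp
      (equivMvPolynomial ℤ).toRingEquiv.toRingHom =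
      (evalEvalRingHom x y).comp (bivariateMap (Int.castRingHom ℂ)) := by
    ext <;> simp [bivariateMap]
  exact congrArg (fun f : ℤ[X][X] →+* ℂ => f P) this

open Polynomial.Bivariate in
lemma map_equivMvPolynomial (P : ℤ[X][X]) :
    MvPolynomial.map (Int.castRingHom ℂ) (equivMvPolynomial ℤ P) =
      equivMvPolynomial ℂ (bivariateMap (Int.castRingHom ℂ) P) := by
  have : (MvPolynomial.map (Int.castRingHom ℂ)).comp
      (equivMvPolynomial ℤ).toRingEquiv.toRingHom =
      (equivMvPolynomial ℂ).toRingEquiv.toRingHom.comp (bivariateMap (Int.castRingHom ℂ)) := by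
    ext <;> simp [bivariateMap]
  exact congrArg (fun f : ℤ[X][X] →+* _ => f P) this

open Polynomial.Bivariate in
lemma aeval_scale_equivMvPolynomial (P : ℤ[X][X]) (a b : ℂ) :
    MvPolynomial.aeval
      ![(MvPolynomial.C a * MvPolynomial.X 0 : MvPolynomial (Fin 2) ℂ),
        MvPolynomial.C b * MvPolynomial.X 1] (equivMvPolynomial ℤ P) =
      equivMvPolynomial ℂ (scaleHom a b (bivariateMap (Int.castRingHom ℂ) P)) := by
  have : ((MvPolynomial.aeval ![(MvPolynomial.C a * MvPolynomial.X 0 : MvPolynomial (Fin 2) ℂ),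
      MvPolynomial.C b * MvPolynomial.X 1]).toRingHom :
        MvPolynomial (Fin 2) ℤ →+* MvPolynomial (Fin 2) ℂ).comp
      (equivMvPolynomial ℤ).toRingEquiv.toRingHom =
      (equivMvPolynomial ℂ).toRingEquiv.toRingHom.comp
        ((scaleHom a b).comp (bivariateMap (Int.castRingHom ℂ))) := by
    ext <;> simp [bivariateMap, scaleHom]
  exact congrArg (fun f : ℤ[X][X] →+* _ => f P) this

lemma isWeberModularPolynomial_equivMvPolynomial {ℓ : ℕ} {P : ℤ[X][X]} :
    IsWeberModularPolynomial ℓ (Polynomial.Bivariate.equivMvPolynomial ℤ P) ↔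
      Irreducible P ∧ IsWeberRelation ℓ (bivariateMap (Int.castRingHom ℂ) P) := by
  refine and_congr (MulEquiv.irreducible_iff (Polynomial.Bivariate.equivMvPolynomial ℤ)) ?_
  simp only [aeval_equivMvPolynomial]
  exact ⟨fun h z hz => h ⟨z, hz⟩, fun h τ => h τ τ.2⟩

end WeberModular

end

theorem mainTheorem4 (ℓ : ℕ) (hℓ : ℓ.Prime) (hℓ48 : Nat.Coprime ℓ 48) :
    (∃ Φ : MvPolynomial (Fin 2) ℤ, WeberModular.IsWeberModularPolynomial ℓ Φ) ∧
    ∀ Φ : MvPolynomial (Fin 2) ℤ, WeberModular.IsWeberModularPolynomial ℓ Φ →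
      ∀ ζ : ℂ, IsPrimitiveRoot ζ 24 →
        MvPolynomial.aeval
            ![MvPolynomial.C ζ * MvPolynomial.X 0, MvPolynomial.C (ζ ^ ℓ) * MvPolynomial.X 1] Φ =
          (MvPolynomial.C (ζ ^ (ℓ + 1)) * MvPolynomial.map (Int.castRingHom ℂ) Φ :
            MvPolynomial (Fin 2) ℂ) := by
  have : Fact ℓ.Prime := ⟨hℓ⟩
  constructor
  · obtain ⟨P, hP⟩ := WeberModular.exists_irreducible_relation hℓ48
    exact ⟨_, WeberModular.isWeberModularPolynomial_equivMvPolynomial.mpr hP⟩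
  · intro Φ hΦ ζ hζ
    obtain ⟨P, rfl⟩ := (Polynomial.Bivariate.equivMvPolynomial ℤ).surjective Φ
    obtain ⟨hirr, hP⟩ := WeberModular.isWeberModularPolynomial_equivMvPolynomial.mp hΦ
    rw [WeberModular.aeval_scale_equivMvPolynomial, WeberModular.map_equivMvPolynomial,
      WeberModular.scaleHom_bivariateMap_eq hℓ48 hirr hP hζ, map_mul,
      Polynomial.Bivariate.equivMvPolynomial_C_C]
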